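/- Let $X\subseteq\mathbb P^n$ be an irreducible (closed) complex projective variety, $Y\subseteq X$ an irreducible closed subvariety (not necessarily smooth), and $U$ a Zariski open subset of $Y$ with $U\subseteq\mathrm{Reg}(Y)$, where $\mathrm{Reg}$ denotes the set of regular points. For $W\in\{X,U\}$ and a regular point $x$ of $W$, let $T_xW\subseteq\mathbb C^{n+1}$ be the linear subspace corresponding to the embedded projective tangent space of $W$ at $x$. The conormal space $C(W)$ is the closure in $\mathbb P^n\times(\mathbb P^n)^*$ (Euclidean topology) of $$\{(x,l)\in\mathbb P^n\times(\mathbb P^n)^*\mid x\in\mathrm{Reg}(W),\ \langle l,T_xW\rangle=0\},$$ and the conormal map is $\kappa_X:C(X)\to X$, $(x,l)\mapsto x$. The pair $(\mathrm{Reg}(X),U)$ satisfies Whitney's condition (a) if for every $y\in U$ and every sequence $x_k\in\mathrm{Reg}(X)$ with $x_k\to y$ for which the limit $T=\lim_k T_{x_k}X$ exists in a Grassmannian (Euclidean topology), one has $T_yU\subseteq T$. In $S=\mathbb C[x_0,\dots,x_n,l_0,\dots,l_n]$ let $I_{C(X)}$ and $I_{C(U)}$ be the bihomogeneous vanishing ideals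 of $C(X)$ and $C(U)$, let $I_Y$ and $I_{Y\setminus U}$ be the ideals of $S$ generated by the homogeneous vanishing ideals in $\mathbb C[x_0,\dots,x_n]$ of $Y$ and of $Y\setminus U$ (the unit ideal if $Y\setminus U=\emptyset$), and let $\mathfrak b=(x_il_j)_{i,j}$ be the irrelevant ideal. Let $$I_{C(X)\cap C(U)}=\big(I_{C(X)}+I_{C(U)}\big):\mathfrak b^\infty,\qquad I_{\kappa_X^{-1}(U)}=\big(I_{C(X)}+I_Y\big):(I_{Y\setminus U}\,\mathfrak b)^\infty ,$$ that is, the saturated bihomogeneous ideals corresponding to the sheaf of ideals $I_{C(X)}+I_{C(U)}$ of $C(X)\cap C(U)$ and to the sheaf of ideals of the scheme-theoretic closure of $\kappa_X^{-1}(U)$. Then $(\mathrm{Reg}(X),U)$ satisfies Whitney's condition (a) if and only if $$\sqrt{I_{C(X)\cap C(U)}}\subseteq\sqrt{I_{\kappa_X^{-1}(U)}}.$$ Moreover, this inclusion of ideals is equivalent to $\kappa_X^{-1}(U)\subseteq C(X)\cap C(U)$. -/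

import Mathlib

open Filter Topology
open scoped LinearAlgebra.Projectivization

/-- Homogeneous coordinate vectors `(v_0, …, v_n)`, with the standard Hermitian structure. -/
abbrev CoordSpace (n : ℕ) : Type := EuclideanSpace ℂ (Fin (n + 1))

/-- Complex projective space `ℙⁿ`. The dual space `(ℙⁿ)^*` is identified with `ℙⁿ` through
coordinates: `l = (l_0 : … : l_n)` is the linear form `v ↦ ∑ i, l_i v_i`. -/
abbrev ProjSpace (n : ℕ) : Type := ℙ ℂ (CoordSpace n)

/-- The Euclidean (classical) topology of `ℙⁿ`: the quotient topology of `ℂⁿ⁺¹ \ {0}`. -/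
noncomputable instance projSpaceTopology (n : ℕ) : TopologicalSpace (ProjSpace n) :=
  TopologicalSpace.coinduced (Projectivization.mk' ℂ (V := CoordSpace n)) inferInstance

/-- The nonzero coordinate vectors that represent the points of `W` (the affine cone over `W`
without its vertex). -/
def affineCone {n : ℕ} (W : Set (ProjSpace n)) : Set (Fin (n + 1) → ℂ) :=
  {a | ∃ (v : CoordSpace n) (hv : v ≠ 0), Projectivization.mk ℂ v hv ∈ W ∧ a = v.ofLp}

/-- The homogeneous vanishing ideal `I(W)` in `ℂ[x_0, …, x_n]`; it is the unit ideal if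
`W` is empty. -/
noncomputable def homogIdeal {n : ℕ} (W : Set (ProjSpace n)) :
    Ideal (MvPolynomial (Fin (n + 1)) ℂ) :=
  MvPolynomial.vanishingIdeal ℂ (affineCone W)

/-- Zariski closed subsets of `ℙⁿ`: common zero sets of homogeneous polynomials. -/
def IsZariskiClosed {n : ℕ} (Z : Set (ProjSpace n)) : Prop :=
  ∃ S : Set (MvPolynomial (Fin (n + 1)) ℂ), (∀ f ∈ S, ∃ d : ℕ, f.IsHomogeneous d) ∧
    ∀ x : ProjSpace n, x ∈ Z ↔ ∀ f ∈ S, MvPolynomial.eval x.rep.ofLp f = 0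

/-- Irreducible (closed) projective varieties in `ℙⁿ`. -/
def IsIrreducibleVariety {n : ℕ} (X : Set (ProjSpace n)) : Prop :=
  IsZariskiClosed X ∧ X.Nonempty ∧
    ∀ A B : Set (ProjSpace n), IsZariskiClosed A → IsZariskiClosed B →
      X ⊆ A ∪ B → X ⊆ A ∨ X ⊆ B

/-- `U` is a Zariski open subset of `Y`. -/
def IsZariskiOpenIn {n : ℕ} (U Y : Set (ProjSpace n)) : Prop :=
  ∃ Z : Set (ProjSpace n), IsZariskiClosed Z ∧ U = Y \ Z

/-- The embedded tangent space `T_x W` at a point `x` of a locally closed `W ⊆ ℙⁿ`, as the linear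
subspace `{v | ∀ f ∈ I(W), ∑ i, ∂f/∂x_i (x) v_i = 0}` of `ℂⁿ⁺¹` (the affine cone of the projective
tangent space). It contains the line `x`, and does not depend on the vector representing `x`, as
`I(W)` is homogeneous. A locally closed set has the same ideal as its Zariski closure. -/
noncomputable def tangentSpaceAt {n : ℕ} (W : Set (ProjSpace n)) (x : ProjSpace n) :
    Submodule ℂ (CoordSpace n) where
  carrier := {v | ∀ f ∈ homogIdeal W,
    ∑ i, MvPolynomial.eval x.rep.ofLp (MvPolynomial.pderiv i f) * v.ofLp i = 0}
  zero_mem' := by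
    intro f _
    simp
  add_mem' := by
    intro v w hv hw f hf
    simp only [WithLp.ofLp_add, Pi.add_apply, mul_add, Finset.sum_add_distrib, hv f hf, hw f hf,
      add_zero]
  smul_mem' := by
    intro c v hv f hf
    have h := hv f hf
    simp only [WithLp.ofLp_smul, Pi.smul_apply, smul_eq_mul, mul_left_comm _ c, ← Finset.mul_sum,
      h, mul_zero]

/-- The regular points of an irreducible locally closed `W ⊆ ℙⁿ`, by the Jacobian criterion: the
points `x ∈ W` where the dimension of the tangent space (in `ℂⁿ⁺¹`) is `dim W + 1`, the Krull
dimension of the homogeneous coordinate ring. -/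
def regPoints {n : ℕ} (W : Set (ProjSpace n)) : Set (ProjSpace n) :=
  {x | x ∈ W ∧ ringKrullDim (MvPolynomial (Fin (n + 1)) ℂ ⧸ homogIdeal W) =
    ((Module.finrank ℂ (tangentSpaceAt W x) : ℕ) : WithBot ℕ∞)}

/-- The pairs `(x, l)` with `x ∈ Reg(W)` and `⟨l, T_x W⟩ = 0`. -/
def conormalPairs {n : ℕ} (W : Set (ProjSpace n)) : Set (ProjSpace n × ProjSpace n) :=
  {p | p.1 ∈ regPoints W ∧ ∀ v ∈ tangentSpaceAt W p.1, ∑ i, p.2.rep.ofLp i * v.ofLp i = 0}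

/-- The conormal space `C(W) ⊆ ℙⁿ × (ℙⁿ)^*`. -/
def conormalSpace {n : ℕ} (W : Set (ProjSpace n)) : Set (ProjSpace n × ProjSpace n) :=
  closure (conormalPairs W)

/-- The conormal map `κ_X : C(X) → ℙⁿ`, `(x, l) ↦ x` (its values lie in `X` when `X` is closed). -/
def conormalMap {n : ℕ} (X : Set (ProjSpace n)) (p : conormalSpace X) : ProjSpace n := p.1.1

/-- The preimage `κ_X⁻¹(U)`, as a subset of `ℙⁿ × (ℙⁿ)^*`. -/
def conormalPreimage {n : ℕ} (X U : Set (ProjSpace n)) : Set (ProjSpace n × ProjSpace n) :=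
  Subtype.val '' (conormalMap X ⁻¹' U)

/-- Convergence of linear subspaces of `ℂⁿ⁺¹` in the Euclidean topology of the Grassmannians, which
is the topology of the space of orthogonal projections. -/
def SubspaceTendsto {n : ℕ} (T : ℕ → Submodule ℂ (CoordSpace n))
    (L : Submodule ℂ (CoordSpace n)) : Prop :=
  Tendsto (fun k => (T k).starProjection) atTop (𝓝 L.starProjection)

/-- Whitney's condition (a) for the pair `(Reg(X), W)` at the point `y ∈ W`: for every sequence
`x_k ∈ Reg(X)` with `x_k → y` such that the limit of the tangent spaces `T_{x_k} X` exists, this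
limit contains `T_y W`. -/
def WhitneyAAt {n : ℕ} (X W : Set (ProjSpace n)) (y : ProjSpace n) : Prop :=
  ∀ (x : ℕ → ProjSpace n) (L : Submodule ℂ (CoordSpace n)),
    (∀ k, x k ∈ regPoints X) → Tendsto x atTop (𝓝 y) →
    SubspaceTendsto (fun k => tangentSpaceAt X (x k)) L → tangentSpaceAt W y ≤ L

/-- The pair `(Reg(X), W)` satisfies Whitney's condition (a), at every point of `W`. -/
def WhitneyA {n : ℕ} (X W : Set (ProjSpace n)) : Prop :=
  ∀ y ∈ W, WhitneyAAt X W y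

/-- The ring `ℂ[x_0, …, x_n, l_0, …, l_n]` of `ℙⁿ × (ℙⁿ)^*`; `Sum.inl i` is the index of
`x_i` and `Sum.inr i` is the index of `l_i`. -/
abbrev BiPoly (n : ℕ) : Type := MvPolynomial (Fin (n + 1) ⊕ Fin (n + 1)) ℂ

/-- The bihomogeneous vanishing ideal of a subset of `ℙⁿ × (ℙⁿ)^*`. -/
noncomputable def bihomogIdeal {n : ℕ} (A : Set (ProjSpace n × ProjSpace n)) : Ideal (BiPoly n) :=
  MvPolynomial.vanishingIdeal ℂ
    {a | ∃ (v l : CoordSpace n) (hv : v ≠ 0) (hl : l ≠ 0),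
      (Projectivization.mk ℂ v hv, Projectivization.mk ℂ l hl) ∈ A ∧ a = Sum.elim v.ofLp l.ofLp}

/-- The ideal of `ℂ[x, l]` generated by the ideal `I(W)` of `ℂ[x]`. -/
noncomputable def extendedIdeal {n : ℕ} (W : Set (ProjSpace n)) : Ideal (BiPoly n) :=
  (homogIdeal W).map (MvPolynomial.rename (Sum.inl : Fin (n + 1) → Fin (n + 1) ⊕ Fin (n + 1)))

/-- The irrelevant ideal of `ℙⁿ × (ℙⁿ)^*`, generated by the products `x_i l_j`. -/
noncomputable def irrelevantIdeal (n : ℕ) : Ideal (BiPoly n) :=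
  Ideal.span {f | ∃ i j : Fin (n + 1), f = MvPolynomial.X (Sum.inl i) * MvPolynomial.X (Sum.inr j)}

/-- The saturation `(J : B^∞) = ⋃ k, (J : B^k)`. -/
def saturation {R : Type*} [CommRing R] (J B : Ideal R) : Ideal R :=
  ⨆ k : ℕ, Submodule.colon J ((B ^ k : Ideal R) : Set R)

/-- The ideal of `C(X) ∩ C(W)`: the sheaf of ideals `I_{C(X)} + I_{C(W)}` on `ℙⁿ × (ℙⁿ)^*`,
written as a saturated bihomogeneous ideal. -/
noncomputable def conormalInterIdeal {n : ℕ} (X W : Set (ProjSpace n)) : Ideal (BiPoly n) :=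
  saturation (bihomogIdeal (conormalSpace X) ⊔ bihomogIdeal (conormalSpace W)) (irrelevantIdeal n)

/-- The ideal of `κ_X⁻¹(U)` for `U` Zariski open in the closed set `Y`. The scheme `κ_X⁻¹(Y)` has
the sheaf of ideals `I_{C(X)} + I_Y`, and `κ_X⁻¹(U)` is its open subscheme off `(Y \ U) × (ℙⁿ)^*`;
saturating with respect to the ideal of `Y \ U` gives the sheaf of ideals of (the scheme-theoretic
closure of) `κ_X⁻¹(U)`, written as a saturated bihomogeneous ideal. If `U = Y` this is the ideal
`I_{C(X)} + I_Y`, saturated. -/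
noncomputable def conormalPreimageIdeal {n : ℕ} (X Y U : Set (ProjSpace n)) : Ideal (BiPoly n) :=
  saturation (bihomogIdeal (conormalSpace X) ⊔ extendedIdeal Y)
    (extendedIdeal (Y \ U) * irrelevantIdeal n)

/-! The geometric half is duality. A form kills a limit of tangent spaces of `X` if it is a limit of
conormal forms. Suppose condition (a) holds and `(y, l)` lies in `C(X)` over `y ∈ U`. Then `(y, l)`
is a limit of conormal pairs whose tangent spaces, along a subsequence, converge to some `L`. The
form `l` kills `L`, hence `T_y U`. Conversely, if `w ∈ T_y U` is not in the limit `L`, the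
conjugated components of `w` orthogonal to `T_{x_k} X` are conormal forms. They converge to a
nonzero form that lies in `C(X)` over `y` but does not kill `w`.

The algebraic half is the Nullstellensatz. The radical of a saturation `J : B^∞` consists of the
polynomials that vanish on `V(J) \ V(B)`, so the inclusion of radicals compares zero sets. For this,
`κ_X⁻¹(U)` must be cut out by polynomials although `C(X)` is a Euclidean closure. The conormal pairs
are described by ranks of gradients, hence by minors, and form a locally closed set; for such a set
the Euclidean closure contains the Zariski closure (`mem_closure_of_vanishingIdeal_le`). That
density statement rests on Noether normalization and on small roots of monic polynomials with small
constant term. For `C(U)` only the part over `U` matters; there all points are regular and the rank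
equations alone define the conormal pairs (`mk_mem_conormalPairs_of_eval_eq_zero`). -/

/-! ### Bounds on roots of monic polynomials -/

/-- A root of a monic complex polynomial is bounded in terms of the coefficients. -/
theorem norm_le_of_isRoot_of_monic {F : Polynomial ℂ} (hF : F.Monic) {z : ℂ} (hz : F.IsRoot z) :
    ‖z‖ ≤ 1 + ∑ k ∈ Finset.range F.natDegree, ‖F.coeff k‖ := by
  have hnn : 0 ≤ ∑ k ∈ Finset.range F.natDegree, ‖F.coeff k‖ :=
    Finset.sum_nonneg fun _ _ => norm_nonneg _
  by_cases h1 : ‖z‖ ≤ 1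
  · linarith
  push Not at h1
  have hz' : ∑ k ∈ Finset.range F.natDegree, F.coeff k * z ^ k + z ^ F.natDegree = 0 := by
    have h := hz.eq_zero
    rw [Polynomial.eval_eq_sum_range, Finset.sum_range_succ, hF.coeff_natDegree, one_mul] at h
    exact h
  obtain ⟨m, hm⟩ : ∃ m, F.natDegree = m + 1 := by
    refine Nat.exists_eq_succ_of_ne_zero fun h0 => ?_
    rw [h0] at hz'
    simp at hz'
  have h2 : ‖z‖ ^ F.natDegree ≤
      (∑ k ∈ Finset.range F.natDegree, ‖F.coeff k‖) * ‖z‖ ^ m := by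
    have h3 : z ^ F.natDegree = -∑ k ∈ Finset.range F.natDegree, F.coeff k * z ^ k := by
      linear_combination hz'
    rw [← norm_pow, h3, norm_neg, Finset.sum_mul]
    refine (norm_sum_le _ _).trans (Finset.sum_le_sum fun k hk => ?_)
    rw [norm_mul, norm_pow]
    have hk' := Finset.mem_range.1 hk
    gcongr
    · exact h1.le
    · omega
  rw [hm, pow_succ'] at h2
  rw [hm]
  have := le_of_mul_le_mul_right h2 (pow_pos (by linarith) m)
  linarith

theorem pow_card_le_norm_prod {s : Multiset ℂ} {ρ : ℝ} (hρ : 0 ≤ ρ) (h : ∀ r ∈ s, ρ ≤ ‖r‖) :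
    ρ ^ s.card ≤ ‖s.prod‖ := by
  induction s using Multiset.induction_on with
  | empty => simp
  | cons a s ih =>
    rw [Multiset.card_cons, Multiset.prod_cons, norm_mul, pow_succ']
    exact mul_le_mul (h a (Multiset.mem_cons_self _ _))
      (ih fun r hr => h r (Multiset.mem_cons_of_mem hr)) (pow_nonneg hρ _) (norm_nonneg _)

/-- A monic complex polynomial with small constant coefficient has a small root. -/
theorem exists_isRoot_norm_pow_le {F : Polynomial ℂ} (hF : F.Monic) (hd : 0 < F.natDegree) :
    ∃ z, F.IsRoot z ∧ ‖z‖ ^ F.natDegree ≤ ‖F.eval 0‖ := by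
  have hs := IsAlgClosed.splits F
  have hcard : F.roots.card = F.natDegree := hs.natDegree_eq_card_roots.symm
  have hne : F.roots.toFinset.Nonempty := by
    rw [Multiset.toFinset_nonempty]
    intro h0
    rw [h0, Multiset.card_zero] at hcard
    omega
  -- A root of least norm works: up to sign the constant coefficient is the product of all roots.
  obtain ⟨z, hz, hmin⟩ := F.roots.toFinset.exists_min_image (fun r => ‖r‖) hne
  refine ⟨z, (Polynomial.mem_roots hF.ne_zero).1 (Multiset.mem_toFinset.1 hz), ?_⟩
  rw [← Polynomial.coeff_zero_eq_eval_zero, hs.coeff_zero_eq_prod_roots_of_monic hF, norm_mul,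
    norm_pow, norm_neg, norm_one, one_pow, one_mul, ← hcard]
  exact pow_card_le_norm_prod (norm_nonneg _) fun r hr => hmin r (Multiset.mem_toFinset.2 hr)

/-! ### Noether normalization on points -/

/-- Over an integrally closed domain, a root of a specialization of the minimal polynomial of `b`
is the value of `b` at a maximal ideal over that specialization. -/
theorem exists_maximal_over_root_minpoly {A B K : Type*} [CommRing A] [IsDomain A]
    [IsIntegrallyClosed A] [CommRing B] [IsDomain B] [Algebra A B] [Module.IsTorsionFree A B]
    [Algebra.IsIntegral A B] [Field K] (χ : A →+* K) (hχ : Function.Surjective χ) (b : B) (η : K)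
    (hη : ((minpoly A b).map χ).IsRoot η) :
    ∃ Q : Ideal B, Q.IsMaximal ∧
      ∀ f : Polynomial A, f.eval₂ χ η = 0 → Polynomial.aeval b f ∈ Q := by
  let θ : Polynomial A →+* B := (Polynomial.aeval b : Polynomial A →ₐ[A] B).toRingHom
  let ψ : Polynomial A →+* K := Polynomial.eval₂RingHom χ η
  have hψ : Function.Surjective ψ := fun z => by
    obtain ⟨a, rfl⟩ := hχ z
    exact ⟨Polynomial.C a, by simp [ψ]⟩
  -- `B` becomes integral over `A[T]` through `T ↦ b`. Lying over then applies to the kernel of `T ↦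
  -- η`, which contains the kernel of `T ↦ b` because that one consists of multiples of the minimal
  -- polynomial.
  let _ : Algebra (Polynomial A) B := θ.toAlgebra
  have : IsScalarTower A (Polynomial A) B := IsScalarTower.of_algebraMap_eq fun a => by
    change _ = Polynomial.aeval b (Polynomial.C a)
    simp
  have : Algebra.IsIntegral (Polynomial A) B := Algebra.IsIntegral.tower_top A
  have : (RingHom.ker ψ).IsMaximal := RingHom.ker_isMaximal_of_surjective ψ hψ
  obtain ⟨Q, hQ, hQ'⟩ := Ideal.exists_ideal_over_maximal_of_isIntegral (S := B) (RingHom.ker ψ)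
    (by
      intro f hf
      have hf' : Polynomial.aeval b f = 0 := hf
      obtain ⟨c, rfl⟩ := minpoly.isIntegrallyClosed_dvd (Algebra.IsIntegral.isIntegral b) hf'
      rw [RingHom.mem_ker, map_mul]
      have : ψ (minpoly A b) = 0 := by
        rw [Polynomial.IsRoot, Polynomial.eval_map] at hη
        exact hη
      rw [this, zero_mul])
  refine ⟨Q, hQ, fun f hf => ?_⟩
  have : f ∈ Q.comap (algebraMap (Polynomial A) B) := by
    rw [hQ']
    exact hf
  exact this

/-- Noether normalization of an irreducible affine variety `V(P)`, on the level of points. -/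
theorem exists_finite_projection {σ : Type*} [Finite σ] (P : Ideal (MvPolynomial σ ℂ))
    [P.IsPrime] :
    ∃ (s : ℕ) (τ : Fin s → MvPolynomial σ ℂ),
      (∀ y : MvPolynomial σ ℂ, ∃ F : Polynomial (MvPolynomial (Fin s) ℂ), F.Monic ∧
        0 < F.natDegree ∧
        (∀ q ∈ MvPolynomial.zeroLocus ℂ P,
          (F.map (MvPolynomial.eval fun j => MvPolynomial.eval q (τ j))).IsRoot
            (MvPolynomial.eval q y)) ∧
        ∀ (t : Fin s → ℂ) (η : ℂ), (F.map (MvPolynomial.eval t)).IsRoot η →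
          ∃ q ∈ MvPolynomial.zeroLocus ℂ P, (∀ j, MvPolynomial.eval q (τ j) = t j) ∧
            MvPolynomial.eval q y = η) ∧
      ∀ g ∉ P, ∃ h : MvPolynomial (Fin s) ℂ, h ≠ 0 ∧ ∀ q ∈ MvPolynomial.zeroLocus ℂ P,
        MvPolynomial.eval (fun j => MvPolynomial.eval q (τ j)) h ≠ 0 →
          MvPolynomial.eval q g ≠ 0 := by
  obtain ⟨B, _, _, _, _, π, hπ, hker⟩ : ∃ (B : Type _) (_ : CommRing B) (_ : IsDomain B)
      (_ : Algebra ℂ B) (_ : Algebra.FiniteType ℂ B) (π : MvPolynomial σ ℂ →ₐ[ℂ] B),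
      Function.Surjective π ∧ ∀ f, π f = 0 ↔ f ∈ P :=
    ⟨MvPolynomial σ ℂ ⧸ P, inferInstance, inferInstance, inferInstance,
      Algebra.FiniteType.of_surjective (Ideal.Quotient.mkₐ ℂ P) Ideal.Quotient.mk_surjective,
      Ideal.Quotient.mkₐ ℂ P, Ideal.Quotient.mk_surjective,
      fun f => Ideal.Quotient.eq_zero_iff_mem⟩
  obtain ⟨s, φ, hφ, hint⟩ := exists_integral_inj_algHom_of_fg ℂ B
  let A := MvPolynomial (Fin s) ℂ
  let _ : Algebra A B := φ.toRingHom.toAlgebra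
  have : Algebra.IsIntegral A B := ⟨hint⟩
  have : Module.IsTorsionFree A B := by
    have : FaithfulSMul A B := (faithfulSMul_iff_algebraMap_injective A B).2 hφ
    infer_instance
  choose τ hτ using fun j : Fin s =>
    hπ (φ (MvPolynomial.X j))
  have hex : ∀ q ∈ MvPolynomial.zeroLocus ℂ P, ∃ p : B →+* ℂ,
      ∀ y, p (π y) = MvPolynomial.eval q y := fun q hq => by
    refine ⟨RingHom.liftOfSurjective π.toRingHom hπ ⟨MvPolynomial.eval q, fun a ha => ?_⟩,
      fun y => RingHom.liftOfSurjective_comp_apply π.toRingHom hπ _ y⟩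
    have := hq a ((hker a).1 ha)
    rwa [MvPolynomial.aeval_eq_eval] at this
  choose pt hpt using hex
  have hptA : ∀ q hq, (pt q hq).comp (algebraMap A B) =
      MvPolynomial.eval fun j => MvPolynomial.eval q (τ j) := by
    intro q hq
    refine MvPolynomial.ringHom_ext (fun r => ?_) fun j => ?_
    · change pt q hq (φ (MvPolynomial.C r)) = _
      have : φ (MvPolynomial.C r) = π (MvPolynomial.C r) :=
        (φ.commutes r).trans (π.commutes r).symm
      rw [this, hpt]
      simp
    · change pt q hq (φ (MvPolynomial.X j)) = _
      rw [← hτ, hpt]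
      simp
  refine ⟨s, τ, fun y => ?_, fun g hg => ?_⟩
  · have hy : IsIntegral A (π y) := Algebra.IsIntegral.isIntegral _
    refine ⟨minpoly A (π y), minpoly.monic hy, minpoly.natDegree_pos hy,
      fun q hq => ?_, fun t η hη => ?_⟩
    · rw [Polynomial.IsRoot, Polynomial.eval_map, ← hptA q hq, ← hpt q hq, ← Polynomial.hom_eval₂]
      have h := minpoly.aeval A (π y)
      rw [Polynomial.aeval_def] at h
      rw [h, map_zero]
    · obtain ⟨Q, hQ, hQ'⟩ := exists_maximal_over_root_minpoly (MvPolynomial.eval t)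
        (fun z => ⟨MvPolynomial.C z, by simp⟩) _ η hη
      have hmax : (Q.comap π).IsMaximal :=
        Ideal.comap_isMaximal_of_surjective _ hπ
      obtain ⟨q, hq⟩ := MvPolynomial.isMaximal_iff_eq_vanishingIdeal_singleton.1 hmax
      have hmem : ∀ f, π f ∈ Q → MvPolynomial.eval q f = 0 := by
        intro f hf
        have : f ∈ MvPolynomial.vanishingIdeal ℂ {q} := by
          rw [← hq]
          exact hf
        simpa [MvPolynomial.aeval_eq_eval] using this
      refine ⟨q, fun f hf => ?_, fun j => ?_, ?_⟩
      · rw [MvPolynomial.aeval_eq_eval]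
        refine hmem f ?_
        rw [(hker f).2 hf]
        exact Q.zero_mem
      · have h1 := hQ' (Polynomial.C (MvPolynomial.X j - MvPolynomial.C (t j))) (by simp)
        have h2 := hmem (τ j - MvPolynomial.C (t j)) (by
          convert h1 using 1
          rw [Polynomial.aeval_C, map_sub, map_sub, hτ]
          congr 1
          exact (π.commutes (t j)).trans (φ.commutes (t j)).symm)
        simpa [sub_eq_zero] using h2
      · have h1 := hQ' (Polynomial.X - Polynomial.C (MvPolynomial.C η)) (by simp)
        have h2 := hmem (y - MvPolynomial.C η) (by
          convert h1 using 1
          rw [map_sub, map_sub, Polynomial.aeval_X, Polynomial.aeval_C]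
          congr 1
          exact (π.commutes η).trans (φ.commutes η).symm)
        simpa [sub_eq_zero] using h2
  · have hg' : π g ≠ 0 := fun h => hg ((hker g).1 h)
    -- In an integral extension of domains a nonzero ideal meets the base ring nontrivially. A
    -- nonzero `h` that becomes a multiple of `π g` vanishes wherever `g` does.
    have h1 := Ideal.comap_ne_bot_of_integral_mem (R := A) hg'
      (Ideal.mem_span_singleton_self (π g)) (Algebra.IsIntegral.isIntegral _)
    obtain ⟨h, hh, hh0⟩ := Submodule.exists_mem_ne_zero_of_ne_bot h1
    refine ⟨h, hh0, fun q hq hne h0 => hne ?_⟩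
    obtain ⟨c, hc⟩ := Ideal.mem_span_singleton.1 (Ideal.mem_comap.1 hh)
    have := congrArg (pt q hq) hc
    rw [map_mul, hpt, h0, zero_mul] at this
    rw [← this, ← hptA q hq]
    rfl

/-! ### Euclidean density of Zariski open sets -/

/-- Off the zero set of a nonzero polynomial one can approach every point. -/
theorem exists_tendsto_eval_ne_zero {σ : Type*} (h : MvPolynomial σ ℂ)
    (h0 : h ≠ 0) (p : σ → ℂ) :
    ∃ t : ℕ → σ → ℂ, Tendsto t atTop (𝓝 p) ∧ ∀ k, MvPolynomial.eval (t k) h ≠ 0 := by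
  obtain ⟨a, ha⟩ : ∃ a, MvPolynomial.eval a h ≠ 0 := by
    by_contra! hc
    exact h0 (MvPolynomial.funext fun x => by rw [hc x, map_zero])
  -- Restrict `h` to the line from `p` to a point `a` with `h(a) ≠ 0`; the restriction has only
  -- finitely many zeros.
  let ℓ : σ → Polynomial ℂ := fun i => Polynomial.C (p i) + Polynomial.X * Polynomial.C (a i - p i)
  let F : Polynomial ℂ := MvPolynomial.eval₂ Polynomial.C ℓ h
  have hF : ∀ z : ℂ, F.eval z = MvPolynomial.eval (fun i => p i + z * (a i - p i)) h := by
    intro z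
    have : (Polynomial.evalRingHom z).comp (MvPolynomial.eval₂Hom Polynomial.C ℓ) =
        MvPolynomial.eval (fun i => p i + z * (a i - p i)) := by
      refine MvPolynomial.ringHom_ext (fun r => by simp) fun i => by simp [ℓ]
    exact congrArg (fun f => f h) this
  have hF0 : F ≠ 0 := by
    intro h1
    have := hF 1
    rw [h1, Polynomial.eval_zero] at this
    exact ha (by simpa using this.symm)
  have hinf : ∀ k : ℕ, ∃ z : ℂ, ‖z‖ ≤ 1 / ((k : ℝ) + 1) ∧ F.eval z ≠ 0 := by
    intro k
    by_contra! hc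
    refine hF0 (Polynomial.eq_zero_of_infinite_isRoot F (Set.Infinite.mono (s :=
      Metric.closedBall (0 : ℂ) (1 / ((k : ℝ) + 1))) (fun z hz => hc z (by simpa using hz)) ?_))
    exact infinite_of_mem_nhds 0 (Metric.closedBall_mem_nhds _ (by positivity))
  choose z hz hz' using hinf
  refine ⟨fun k i => p i + z k * (a i - p i), ?_, fun k => by rw [← hF]; exact hz' k⟩
  have hz0 : Tendsto z atTop (𝓝 0) :=
    squeeze_zero_norm hz tendsto_one_div_add_atTop_nhds_zero_nat
  rw [tendsto_pi_nhds]
  intro i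
  simpa using (tendsto_const_nhds (x := p i)).add (hz0.mul_const (a i - p i))

/-- A polynomial vanishing at `p`, but at no other point of a finite set. -/
theorem exists_eval_eq_zero_separating {σ : Type*} (p : σ → ℂ) {S : Set (σ → ℂ)} (hS : S.Finite) :
    ∃ y : MvPolynomial σ ℂ, MvPolynomial.eval p y = 0 ∧
      ∀ q ∈ S, MvPolynomial.eval q y = 0 → q = p := by
  have h1 : ∀ q : σ → ℂ, ∃ f : MvPolynomial σ ℂ, MvPolynomial.eval p f = 1 ∧
      (q ≠ p → MvPolynomial.eval q f = 0) := by
    intro q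
    by_cases hq : q = p
    · exact ⟨1, by simp, fun h => absurd hq h⟩
    · obtain ⟨i, hi⟩ := Function.ne_iff.1 hq
      refine ⟨(MvPolynomial.X i - MvPolynomial.C (q i)) * MvPolynomial.C (p i - q i)⁻¹, ?_, ?_⟩
      · have : p i - q i ≠ 0 := sub_ne_zero.2 (Ne.symm hi)
        simp [this]
      · simp
  choose f hf hf' using h1
  refine ⟨1 - ∏ q ∈ hS.toFinset, f q, by simp [hf], fun q hq h => ?_⟩
  by_contra hne
  have : MvPolynomial.eval q (∏ q ∈ hS.toFinset, f q) = 0 := by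
    rw [map_prod]
    exact Finset.prod_eq_zero (hS.mem_toFinset.2 hq) (hf' q hne)
  rw [map_sub, this] at h
  simp at h

theorem continuous_eval_coeff {s : ℕ} (F : Polynomial (MvPolynomial (Fin s) ℂ)) (k : ℕ) :
    Continuous fun t => (F.map (MvPolynomial.eval t)).coeff k := by
  simp only [Polynomial.coeff_map]
  exact MvPolynomial.continuous_eval _

/-- In an irreducible affine variety, the complement of a hypersurface is dense in the Euclidean
topology. -/
theorem mem_closure_zeroLocus_diff_of_isPrime {σ : Type*} [Fintype σ]
    (P : Ideal (MvPolynomial σ ℂ)) [P.IsPrime] {g : MvPolynomial σ ℂ} (hg : g ∉ P) {p : σ → ℂ}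
    (hp : p ∈ MvPolynomial.zeroLocus ℂ P) :
    p ∈ closure {a | a ∈ MvPolynomial.zeroLocus ℂ P ∧ MvPolynomial.eval a g ≠ 0} := by
  obtain ⟨s, τ, hproj, hden⟩ := exists_finite_projection P
  obtain ⟨h, hh0, hh⟩ := hden g hg
  choose G hGm _ hGr _ using fun i => hproj (MvPolynomial.X i)
  set t₀ : Fin s → ℂ := fun j => MvPolynomial.eval p (τ j)
  -- The fibre of the projection through `p` is finite, since each coordinate is a root of a fixed
  -- monic polynomial.
  have hfin : {q | q ∈ MvPolynomial.zeroLocus ℂ P ∧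
      ∀ j, MvPolynomial.eval q (τ j) = t₀ j}.Finite := by
    refine Set.Finite.subset (Set.Finite.pi fun i => Set.Finite.ofFinset
      ((G i).map (MvPolynomial.eval t₀)).roots.toFinset fun _ => Iff.rfl) fun q hq => ?_
    rw [Set.mem_univ_pi]
    intro i
    have h1 := hGr i q hq.1
    rw [funext hq.2, MvPolynomial.eval_X] at h1
    exact Multiset.mem_toFinset.2 ((Polynomial.mem_roots ((hGm i).map _).ne_zero).2 h1)
  obtain ⟨y, hyp, hysep⟩ := exists_eval_eq_zero_separating p hfin
  obtain ⟨F, hFm, hFd, hFr, hFl⟩ := hproj y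
  obtain ⟨t, ht, hth⟩ := exists_tendsto_eval_ne_zero h hh0 t₀
  -- The function `y` separates `p` from the rest of its fibre, so a nearby point is sought over `t
  -- k` with small `y`-value. The constant coefficient of `F` at `t₀` is zero because `y(p) = 0`, so
  -- the smallest roots at `t k` tend to zero.
  have hη : ∀ k, ∃ η, (F.map (MvPolynomial.eval (t k))).IsRoot η ∧
      ‖η‖ ^ F.natDegree ≤ ‖(F.map (MvPolynomial.eval (t k))).coeff 0‖ := by
    intro k
    have hd := hFm.natDegree_map (MvPolynomial.eval (t k))
    obtain ⟨η, h1, h2⟩ := exists_isRoot_norm_pow_le (hFm.map (MvPolynomial.eval (t k)))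
      (by rw [hd]; exact hFd)
    exact ⟨η, h1, by rwa [hd, ← Polynomial.coeff_zero_eq_eval_zero] at h2⟩
  choose η hηr hηb using hη
  choose q hqP hqt hqy using fun k => hFl (t k) (η k) (hηr k)
  have hη0 : Tendsto η atTop (𝓝 0) := by
    have h0 : (F.map (MvPolynomial.eval t₀)).coeff 0 = 0 := by
      have := hFr p hp
      rw [hyp] at this
      rw [Polynomial.coeff_zero_eq_eval_zero]
      exact this
    have h1 : Tendsto (fun k => ‖(F.map (MvPolynomial.eval (t k))).coeff 0‖) atTop (𝓝 0) := by
      have := (((continuous_eval_coeff F 0).tendsto t₀).comp ht).norm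
      rwa [h0, norm_zero] at this
    have h2 : Tendsto (fun k => ‖η k‖ ^ F.natDegree) atTop (𝓝 0) :=
      squeeze_zero (fun k => by positivity) hηb h1
    rw [tendsto_zero_iff_norm_tendsto_zero]
    have h3 := h2.rpow_const (p := ((F.natDegree : ℝ)⁻¹)) (Or.inr (by positivity))
    rw [Real.zero_rpow (by positivity)] at h3
    refine h3.congr fun k => ?_
    exact Real.pow_rpow_inv_natCast (norm_nonneg _) hFd.ne'
  -- Properness of the finite projection: coordinates are roots of monic polynomials whose
  -- coefficients stay bounded along `t k`.
  have hbdd : ∃ R : ℝ, ∀ k, q k ∈ Metric.closedBall (0 : σ → ℂ) R := by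
    have hb : ∀ i, ∃ R : ℝ, ∀ k, ‖q k i‖ ≤ R := by
      intro i
      have hc : Continuous fun t' : Fin s → ℂ => 1 + ∑ m ∈ Finset.range (G i).natDegree,
          ‖((G i).map (MvPolynomial.eval t')).coeff m‖ :=
        continuous_const.add (continuous_finsetSum _ fun m _ => (continuous_eval_coeff _ m).norm)
      obtain ⟨R, hR⟩ := ((hc.tendsto t₀).comp ht).bddAbove_range
      refine ⟨R, fun k => le_trans ?_ (hR ⟨k, rfl⟩)⟩
      have h1 := hGr i (q k) (hqP k)
      rw [funext (hqt k), MvPolynomial.eval_X] at h1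
      have h2 := norm_le_of_isRoot_of_monic ((hGm i).map _) h1
      rwa [(hGm i).natDegree_map] at h2
    choose R hR using hb
    refine ⟨∑ i, |R i|, fun k => ?_⟩
    rw [mem_closedBall_zero_iff, pi_norm_le_iff_of_nonneg (by positivity)]
    intro i
    exact (hR i k).trans ((le_abs_self _).trans
      (Finset.single_le_sum (f := fun i => |R i|) (fun _ _ => abs_nonneg _) (Finset.mem_univ i)))
  obtain ⟨R, hR⟩ := hbdd
  obtain ⟨q', -, u, hu, hlim⟩ := (isCompact_closedBall (0 : σ → ℂ) R).tendsto_subseq hR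
  have hev : ∀ f : MvPolynomial σ ℂ, Tendsto (fun k => MvPolynomial.eval (q (u k)) f) atTop
      (𝓝 (MvPolynomial.eval q' f)) := fun f =>
    ((MvPolynomial.continuous_eval f).tendsto q').comp hlim
  have hq'P : q' ∈ MvPolynomial.zeroLocus ℂ P := by
    intro f hf
    rw [MvPolynomial.aeval_eq_eval]
    refine tendsto_nhds_unique (hev f) (tendsto_const_nhds.congr fun k => ?_)
    have := hqP (u k) f hf
    rw [MvPolynomial.aeval_eq_eval] at this
    exact this.symm
  have hq'p : q' = p := by
    refine hysep q' ⟨hq'P, fun j => ?_⟩ ?_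
    · refine tendsto_nhds_unique (hev (τ j)) ?_
      simp only [hqt]
      exact (tendsto_pi_nhds.1 ht j).comp hu.tendsto_atTop
    · refine tendsto_nhds_unique (hev y) ?_
      simp only [hqy]
      exact hη0.comp hu.tendsto_atTop
  rw [← hq'p]
  refine mem_closure_of_tendsto hlim (Eventually.of_forall fun k => ⟨hqP _, hh _ (hqP _) ?_⟩)
  rw [Function.comp_apply, funext (hqt (u k))]
  exact hth _

/-- The Euclidean closure of a locally closed affine set contains its Zariski closure. -/
theorem mem_closure_of_vanishingIdeal_le {σ : Type*} [Fintype σ] (E G : Set (MvPolynomial σ ℂ))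
    {p : σ → ℂ}
    (hp : ∀ f : MvPolynomial σ ℂ, (∀ a, (∀ e ∈ E, MvPolynomial.eval a e = 0) →
      (∃ g ∈ G, MvPolynomial.eval a g ≠ 0) → MvPolynomial.eval a f = 0) →
        MvPolynomial.eval p f = 0) :
    p ∈ closure {a | (∀ e ∈ E, MvPolynomial.eval a e = 0) ∧ ∃ g ∈ G, MvPolynomial.eval a g ≠ 0} := by
  obtain ⟨G₀, hG₀, hspan⟩ := (Submodule.fg_span_iff_fg_span_finset_subset G).1
    (IsNoetherian.noetherian (Ideal.span G))
  have hvan : ∀ a, (∃ g ∈ G, MvPolynomial.eval a g ≠ 0) → ∃ g ∈ G₀, MvPolynomial.eval a g ≠ 0 := by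
    rintro a ⟨g, hg, hga⟩
    by_contra! hc
    have h1 : Ideal.span (G₀ : Set (MvPolynomial σ ℂ)) ≤ RingHom.ker (MvPolynomial.eval a) :=
      Ideal.span_le.2 fun f hf => hc f hf
    exact hga (h1 (hspan.le (Submodule.subset_span hg)))
  -- One `g` suffices: if each of the finitely many `g` had a bad `f g`, their product would
  -- contradict `hp`.
  obtain ⟨g, hgG, hgp⟩ : ∃ g ∈ G₀, ∀ f : MvPolynomial σ ℂ,
      (∀ a, (∀ e ∈ E, MvPolynomial.eval a e = 0) → MvPolynomial.eval a g ≠ 0 →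
        MvPolynomial.eval a f = 0) → MvPolynomial.eval p f = 0 := by
    by_contra! hc
    choose! f hf hfp using hc
    have h1 := hp (∏ g ∈ G₀, f g) fun a haE hag => by
      obtain ⟨g, hg, hga⟩ := hvan a hag
      rw [map_prod]
      exact Finset.prod_eq_zero hg (hf g hg a haE hga)
    rw [map_prod, Finset.prod_eq_zero_iff] at h1
    obtain ⟨g, hg, h2⟩ := h1
    exact hfp g hg h2
  -- This yields a prime above `E` that avoids `g` and lies inside the ideal of `p`: an irreducible
  -- variety through `p`, not contained in `g = 0`.
  have hpow : Disjoint (Ideal.span E : Set (MvPolynomial σ ℂ))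
      ((Submonoid.powers g ⊔ (MvPolynomial.vanishingIdeal ℂ {p}).primeCompl :
        Submonoid (MvPolynomial σ ℂ)) : Set (MvPolynomial σ ℂ)) := by
    rw [Set.disjoint_left]
    intro f hfE hf
    obtain ⟨_, ⟨k, rfl⟩, w, hw, rfl⟩ := Submonoid.mem_sup.1 hf
    refine hw ((MvPolynomial.mem_vanishingIdeal_singleton_iff _ _).2 ?_)
    rw [MvPolynomial.aeval_eq_eval]
    refine hgp w fun a haE hag => ?_
    have h1 : Ideal.span E ≤ RingHom.ker (MvPolynomial.eval a) :=
      Ideal.span_le.2 fun f hf => haE f hf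
    have h2 : MvPolynomial.eval a (g ^ k * w) = 0 := h1 hfE
    rw [map_mul, map_pow] at h2
    exact (mul_eq_zero.1 h2).resolve_left (pow_ne_zero _ hag)
  obtain ⟨P, hP, hEP, hPd⟩ := Ideal.exists_le_prime_disjoint _ _ hpow
  have hgP : g ∉ P := fun h => Set.disjoint_left.1 hPd h
    ((le_sup_left : Submonoid.powers g ≤ _) (Submonoid.mem_powers g))
  have hpP : p ∈ MvPolynomial.zeroLocus ℂ P := by
    intro f hf
    by_contra hne
    refine Set.disjoint_left.1 hPd hf ((le_sup_right :
      (MvPolynomial.vanishingIdeal ℂ {p}).primeCompl ≤ _) fun h => hne ?_)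
    exact (MvPolynomial.mem_vanishingIdeal_singleton_iff _ _).1 h
  refine closure_mono ?_ (mem_closure_zeroLocus_diff_of_isPrime P hgP hpP)
  rintro a ⟨haP, hag⟩
  refine ⟨fun e he => ?_, g, hG₀ hgG, hag⟩
  have := haP e (hEP (Ideal.subset_span he))
  rwa [MvPolynomial.aeval_eq_eval] at this

/-! ### Linear algebra: gradients and minors -/

/-- The constant matrix `W` replaces the choice of columns in a minor. Independent rows have a right
inverse, and an invertible product makes the row combination map injective. -/
theorem linearIndependent_iff_exists_det_ne_zero {K : Type*} [Field K] {m r : ℕ}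
    (u : Fin r → Fin m → K) :
    LinearIndependent K u ↔ ∃ W : Matrix (Fin m) (Fin r) K, (Matrix.of u * W).det ≠ 0 := by
  constructor
  · intro h
    have hinj : Function.Injective (Matrix.of u).vecMul := Matrix.vecMul_injective_iff.2 h
    obtain ⟨g, hg⟩ := (Matrix.of u).vecMulLinear.exists_leftInverse_of_injective
      (LinearMap.ker_eq_bot.2 hinj)
    refine ⟨(LinearMap.toMatrix' g).transpose, ?_⟩
    have : Matrix.of u * (LinearMap.toMatrix' g).transpose = 1 := by
      refine Matrix.ext_of_single_vecMul fun i => ?_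
      rw [← Matrix.vecMul_vecMul, Matrix.vecMul_transpose, LinearMap.toMatrix'_mulVec,
        Matrix.vecMul_one]
      exact congrArg (fun f => f (Pi.single i 1)) hg
    rw [this, Matrix.det_one]
    exact one_ne_zero
  · rintro ⟨W, hW⟩
    have h1 : Function.Injective (Matrix.of u * W).vecMul :=
      Matrix.vecMul_injective_iff_isUnit.2
        ((Matrix.isUnit_iff_isUnit_det _).2 (isUnit_iff_ne_zero.2 hW))
    have h2 : Function.Injective (Matrix.of u).vecMul := fun c d hcd => h1 (by
      change Matrix.vecMul c (Matrix.of u * W) = Matrix.vecMul d (Matrix.of u * W)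
      rw [← Matrix.vecMul_vecMul, ← Matrix.vecMul_vecMul]
      exact congrArg (fun x => Matrix.vecMul x W) hcd)
    exact Matrix.vecMul_injective_iff.1 h2

theorem exists_linearIndependent_iff_le_finrank_span {K V : Type*} [Field K] [AddCommGroup V]
    [Module K V] [FiniteDimensional K V] (S : Set V) (r : ℕ) :
    (∃ u : Fin r → V, (∀ i, u i ∈ S) ∧ LinearIndependent K u) ↔
      r ≤ Module.finrank K (Submodule.span K S) := by
  constructor
  · rintro ⟨u, hu, hli⟩
    have := finrank_span_eq_card hli
    rw [Fintype.card_fin] at this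
    rw [← this]
    exact Submodule.finrank_mono (Submodule.span_mono (Set.range_subset_iff.2 hu))
  · intro h
    obtain ⟨f, hf, -, hli⟩ := Submodule.exists_fun_fin_finrank_span_eq K S
    exact ⟨fun i => f (Fin.castLE h i), fun i => hf _,
      hli.comp _ (Fin.castLE_injective h)⟩

/-- The vectors of a subspace `T` of `ℂⁿ⁺¹` cut out by linear forms in `G`, as the orthogonal
complement for the bilinear dot product. -/
theorem finrank_add_finrank_of_mem_iff {n : ℕ} (T : Submodule ℂ (CoordSpace n))
    (G : Submodule ℂ (Fin (n + 1) → ℂ))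
    (h : ∀ w : CoordSpace n, w ∈ T ↔ ∀ g ∈ G, ∑ i, g i * w.ofLp i = 0) :
    Module.finrank ℂ G + Module.finrank ℂ T = n + 1 ∧
      ∀ l : Fin (n + 1) → ℂ, l ∈ G ↔ ∀ w ∈ T, ∑ i, l i * w.ofLp i = 0 := by
  let e := dotProductEquiv ℂ (Fin (n + 1))
  let Φ : Subspace ℂ (Module.Dual ℂ (Fin (n + 1) → ℂ)) := G.map (e : _ →ₗ[ℂ] _)
  let ι := WithLp.linearEquiv 2 ℂ (Fin (n + 1) → ℂ)
  have he : ∀ a b : Fin (n + 1) → ℂ, e a b = ∑ i, a i * b i := fun a b => rfl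
  have hT : ∀ w : CoordSpace n, w ∈ T ↔ w.ofLp ∈ Φ.dualCoannihilator := by
    intro w
    rw [h, Submodule.mem_dualCoannihilator]
    constructor
    · rintro hw _ ⟨g, hg, rfl⟩
      exact hw g hg
    · intro hw g hg
      exact hw _ ⟨g, hg, rfl⟩
  have hT' : T.map (ι : _ →ₗ[ℂ] _) = Φ.dualCoannihilator := by
    ext w
    constructor
    · rintro ⟨x, hx, rfl⟩
      exact (hT x).1 hx
    · intro hw
      exact ⟨WithLp.toLp 2 w, (hT _).2 hw, rfl⟩
  constructor
  · have h1 := Subspace.finrank_add_finrank_dualCoannihilator_eq Φ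
    rw [← hT', LinearEquiv.finrank_map_eq, LinearEquiv.finrank_map_eq, Module.finrank_fin_fun] at h1
    exact h1
  · intro l
    have h1 : Φ.dualCoannihilator.dualAnnihilator = Φ :=
      Subspace.dualCoannihilator_dualAnnihilator_eq
    have h2 : l ∈ G ↔ e l ∈ Φ := by
      constructor
      · intro hl
        exact ⟨l, hl, rfl⟩
      · rintro ⟨g, hg, hgl⟩
        rwa [← e.injective hgl]
    rw [h2, ← h1, Submodule.mem_dualAnnihilator]
    constructor
    · intro hl w hw
      exact hl _ ((hT w).1 hw)
    · intro hl w hw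
      exact hl (WithLp.toLp 2 w) ((hT _).2 hw)

/-- The gradient of a polynomial at a point. -/
noncomputable def gradientAt {n : ℕ} (a : Fin (n + 1) → ℂ)
    (f : MvPolynomial (Fin (n + 1)) ℂ) : Fin (n + 1) → ℂ :=
  fun i => MvPolynomial.eval a (MvPolynomial.pderiv i f)

/-- The space of gradients at a point of the elements of an ideal. -/
noncomputable def gradientSpace {n : ℕ} (I : Ideal (MvPolynomial (Fin (n + 1)) ℂ))
    (a : Fin (n + 1) → ℂ) : Submodule ℂ (Fin (n + 1) → ℂ) where
  carrier := gradientAt a '' I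
  zero_mem' := ⟨0, I.zero_mem, by funext i; simp [gradientAt]⟩
  add_mem' := by
    rintro _ _ ⟨f, hf, rfl⟩ ⟨g, hg, rfl⟩
    exact ⟨f + g, I.add_mem hf hg, by funext i; simp [gradientAt]⟩
  smul_mem' := by
    rintro c _ ⟨f, hf, rfl⟩
    refine ⟨MvPolynomial.C c * f, I.mul_mem_left _ hf, ?_⟩
    funext i
    simp [gradientAt]

theorem eval_bind₁_smul {n : ℕ} (c : ℂ) (a : Fin (n + 1) → ℂ)
    (f : MvPolynomial (Fin (n + 1)) ℂ) :
    MvPolynomial.eval a (MvPolynomial.bind₁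
      (fun i => MvPolynomial.C c * MvPolynomial.X i) f) = MvPolynomial.eval (c • a) f := by
  induction f using MvPolynomial.induction_on with
  | C r => simp
  | add p q hp hq => simp only [map_add, hp, hq]
  | mul_X p i hp =>
    rw [map_mul, map_mul, hp, MvPolynomial.bind₁_X_right]
    simp

/-- Chain rule for `x ↦ c x`. It makes the gradient space independent of the coordinate vector
chosen for a point. -/
theorem gradient_bind₁_smul {n : ℕ} (c : ℂ) (a : Fin (n + 1) → ℂ)
    (f : MvPolynomial (Fin (n + 1)) ℂ) :
    gradientAt a (MvPolynomial.bind₁ (fun i => MvPolynomial.C c * MvPolynomial.X i) f) =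
      c • gradientAt (c • a) f := by
  funext j
  simp only [gradientAt, Pi.smul_apply, smul_eq_mul]
  induction f using MvPolynomial.induction_on with
  | C r => simp
  | add p q hp hq => simp only [map_add, hp, hq, mul_add]
  | mul_X p i hp =>
    rw [map_mul, MvPolynomial.bind₁_X_right, MvPolynomial.pderiv_mul, map_add, map_mul, map_mul,
      hp, MvPolynomial.pderiv_C_mul, map_mul (MvPolynomial.eval a) (MvPolynomial.bind₁ _ p),
      eval_bind₁_smul, MvPolynomial.pderiv_mul, map_add, map_mul, map_mul]
    by_cases hij : i = j
    · subst hij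
      simp
      ring
    · rw [MvPolynomial.pderiv_X_of_ne hij]
      simp
      ring

/-! ### Homogeneous coordinates -/

theorem affineCone_smul_mem {n : ℕ} {W : Set (ProjSpace n)} {a : Fin (n + 1) → ℂ}
    (ha : a ∈ affineCone W) {c : ℂ} (hc : c ≠ 0) : c • a ∈ affineCone W := by
  obtain ⟨v, hv, hvW, rfl⟩ := ha
  refine ⟨c • v, smul_ne_zero hc hv, ?_, rfl⟩
  rwa [(Projectivization.mk_eq_mk_iff' ℂ _ _ (smul_ne_zero hc hv) hv).2 ⟨c, rfl⟩]

theorem bind₁_smul_mem_homogIdeal {n : ℕ} {W : Set (ProjSpace n)}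
    {f : MvPolynomial (Fin (n + 1)) ℂ} (hf : f ∈ homogIdeal W) {c : ℂ} (hc : c ≠ 0) :
    MvPolynomial.bind₁ (fun i => MvPolynomial.C c * MvPolynomial.X i) f ∈ homogIdeal W := by
  intro a ha
  rw [MvPolynomial.aeval_eq_eval, eval_bind₁_smul]
  have := hf _ (affineCone_smul_mem ha hc)
  rwa [MvPolynomial.aeval_eq_eval] at this

theorem gradientSpace_smul_le {n : ℕ} (W : Set (ProjSpace n)) (a : Fin (n + 1) → ℂ) {c : ℂ}
    (hc : c ≠ 0) : gradientSpace (homogIdeal W) (c • a) ≤ gradientSpace (homogIdeal W) a := by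
  rintro _ ⟨f, hf, rfl⟩
  have h := (gradientSpace (homogIdeal W) a).smul_mem c⁻¹
    ⟨_, bind₁_smul_mem_homogIdeal hf hc, rfl⟩
  rwa [gradient_bind₁_smul, inv_smul_smul₀ hc] at h

theorem gradientSpace_smul {n : ℕ} (W : Set (ProjSpace n)) (a : Fin (n + 1) → ℂ) {c : ℂ}
    (hc : c ≠ 0) : gradientSpace (homogIdeal W) (c • a) = gradientSpace (homogIdeal W) a := by
  refine le_antisymm (gradientSpace_smul_le W a hc) ?_
  have := gradientSpace_smul_le W (c • a) (inv_ne_zero hc)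
  rwa [inv_smul_smul₀ hc] at this

/-- Scaling invariance of the gradient space removes the chosen representative `rep` from the
definition. -/
theorem mem_tangentSpaceAt_mk {n : ℕ} (W : Set (ProjSpace n)) {v : CoordSpace n} (hv : v ≠ 0)
    (w : CoordSpace n) : w ∈ tangentSpaceAt W (Projectivization.mk ℂ v hv) ↔
      ∀ g ∈ gradientSpace (homogIdeal W) v.ofLp, ∑ i, g i * w.ofLp i = 0 := by
  obtain ⟨c, hc⟩ := Projectivization.exists_smul_eq_mk_rep ℂ v hv
  rw [← gradientSpace_smul W v.ofLp c.ne_zero]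
  have h1 : (c : ℂ) • v.ofLp = (Projectivization.mk ℂ v hv).rep.ofLp := by
    rw [← hc]
    rfl
  rw [h1]
  constructor
  · rintro hw _ ⟨f, hf, rfl⟩
    exact hw f hf
  · intro hw f hf
    exact hw _ ⟨f, hf, rfl⟩

theorem sum_rep_mk_mul_eq_zero_iff {n : ℕ} {l : CoordSpace n} (hl : l ≠ 0) (w : CoordSpace n) :
    ∑ i, (Projectivization.mk ℂ l hl).rep.ofLp i * w.ofLp i = 0 ↔
      ∑ i, l.ofLp i * w.ofLp i = 0 := by
  obtain ⟨c, hc⟩ := Projectivization.exists_smul_eq_mk_rep ℂ l hl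
  rw [← hc]
  have : ∑ i, (c • l).ofLp i * w.ofLp i = (c : ℂ) * ∑ i, l.ofLp i * w.ofLp i := by
    rw [Finset.mul_sum]
    exact Finset.sum_congr rfl fun i _ => mul_assoc _ _ _
  rw [this, mul_eq_zero, or_iff_right c.ne_zero]

/-- The conormal condition in terms of ranks of gradients. -/
theorem mk_mem_conormalPairs_iff {n : ℕ} (W : Set (ProjSpace n)) {v l : CoordSpace n}
    (hv : v ≠ 0) (hl : l ≠ 0) :
    (Projectivization.mk ℂ v hv, Projectivization.mk ℂ l hl) ∈ conormalPairs W ↔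
      Projectivization.mk ℂ v hv ∈ W ∧ ∃ d r : ℕ, d + r = n + 1 ∧
        ringKrullDim (MvPolynomial (Fin (n + 1)) ℂ ⧸ homogIdeal W) = (d : WithBot ℕ∞) ∧
        r ≤ Module.finrank ℂ (gradientSpace (homogIdeal W) v.ofLp) ∧
        Module.finrank ℂ
          (gradientSpace (homogIdeal W) v.ofLp ⊔ Submodule.span ℂ {l.ofLp} :
            Submodule ℂ (Fin (n + 1) → ℂ)) ≤ r := by
  obtain ⟨hfin, hmem⟩ := finrank_add_finrank_of_mem_iff _ _ (mem_tangentSpaceAt_mk W hv)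
  have hcond : (∀ w ∈ tangentSpaceAt W (Projectivization.mk ℂ v hv),
      ∑ i, (Projectivization.mk ℂ l hl).rep.ofLp i * w.ofLp i = 0) ↔
        l.ofLp ∈ gradientSpace (homogIdeal W) v.ofLp := by
    rw [hmem]
    exact forall₂_congr fun w _ => sum_rep_mk_mul_eq_zero_iff hl w
  change (_ ∧ _) ∧ (∀ w ∈ tangentSpaceAt W (Projectivization.mk ℂ v hv), _) ↔ _
  rw [hcond, and_assoc]
  refine and_congr_right fun _ => ?_
  constructor
  · rintro ⟨hd, hlG⟩
    refine ⟨_, Module.finrank ℂ (gradientSpace (homogIdeal W) v.ofLp), by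
      rw [add_comm]; exact hfin, hd, le_rfl, ?_⟩
    rw [sup_eq_left.2 (Submodule.span_le.2 (Set.singleton_subset_iff.2 hlG))]
  -- The two rank bounds squeeze: adjoining `l` does not enlarge the gradient space, whose dimension
  -- is exactly `r`.
  · rintro ⟨d, r, hdr, hd, hr1, hr2⟩
    have heq : gradientSpace (homogIdeal W) v.ofLp =
        gradientSpace (homogIdeal W) v.ofLp ⊔ Submodule.span ℂ {l.ofLp} :=
      Submodule.eq_of_le_of_finrank_le le_sup_left (hr2.trans hr1)
    have hr3 := hr2
    rw [← heq] at hr3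
    constructor
    · rw [hd]
      have : d = Module.finrank ℂ (tangentSpaceAt W (Projectivization.mk ℂ v hv)) := by omega
      rw [this]
    · rw [heq]
      exact Submodule.mem_sup_right (Submodule.mem_span_singleton_self _)

/-! ### Minors as polynomials -/

/-- The determinant of a polynomial matrix multiplied by a constant one. -/
noncomputable def mixedMinor {n r : ℕ} (R : Fin r → Fin (n + 1) → BiPoly n)
    (W : Matrix (Fin (n + 1)) (Fin r) ℂ) : BiPoly n :=
  ((Matrix.of R : Matrix (Fin r) (Fin (n + 1)) (BiPoly n)) *
    (W.map MvPolynomial.C : Matrix (Fin (n + 1)) (Fin r) (BiPoly n))).det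

theorem eval_mixedMinor {n r : ℕ} (R : Fin r → Fin (n + 1) → BiPoly n)
    (W : Matrix (Fin (n + 1)) (Fin r) ℂ) (a : Fin (n + 1) ⊕ Fin (n + 1) → ℂ) :
    MvPolynomial.eval a (mixedMinor R W) =
      (Matrix.of (fun i k => MvPolynomial.eval a (R i k)) * W).det := by
  rw [mixedMinor, RingHom.map_det]
  congr 1
  ext i j
  simp [Matrix.mul_apply]

/-- Minors of size `r` with rows taken from a set `S` of polynomial vectors. -/
def minorSet {n : ℕ} (S : Set (Fin (n + 1) → BiPoly n)) (r : ℕ) : Set (BiPoly n) :=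
  {g | ∃ (R : Fin r → Fin (n + 1) → BiPoly n) (W : Matrix (Fin (n + 1)) (Fin r) ℂ),
    (∀ i, R i ∈ S) ∧ g = mixedMinor R W}

theorem exists_minorSet_eval_ne_zero_iff {n : ℕ} (S : Set (Fin (n + 1) → BiPoly n)) (r : ℕ)
    (a : Fin (n + 1) ⊕ Fin (n + 1) → ℂ) :
    (∃ g ∈ minorSet S r, MvPolynomial.eval a g ≠ 0) ↔
      r ≤ Module.finrank ℂ
        (Submodule.span ℂ ((fun R k => MvPolynomial.eval a (R k)) '' S)) := by
  rw [← exists_linearIndependent_iff_le_finrank_span]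
  constructor
  · rintro ⟨_, ⟨R, W, hR, rfl⟩, hne⟩
    rw [eval_mixedMinor] at hne
    exact ⟨fun i k => MvPolynomial.eval a (R i k), fun i => ⟨R i, hR i, rfl⟩,
      (linearIndependent_iff_exists_det_ne_zero _).2 ⟨W, hne⟩⟩
  · rintro ⟨u, hu, hli⟩
    choose R hR hRu using hu
    obtain ⟨W, hW⟩ := (linearIndependent_iff_exists_det_ne_zero _).1 hli
    refine ⟨_, ⟨R, W, hR, rfl⟩, ?_⟩
    rw [eval_mixedMinor]
    have : (fun i k => MvPolynomial.eval a (R i k)) = u := funext hRu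
    rw [this]
    exact hW

/-- The gradients of the elements of an ideal, as vectors of polynomials in `(x, l)`. -/
noncomputable def gradientRows {n : ℕ} (I : Ideal (MvPolynomial (Fin (n + 1)) ℂ)) :
    Set (Fin (n + 1) → BiPoly n) :=
  (fun f k => MvPolynomial.rename Sum.inl (MvPolynomial.pderiv k f)) '' I

/-- The vector `(l_0, …, l_n)`. -/
noncomputable def dualRow (n : ℕ) : Fin (n + 1) → BiPoly n := fun k => MvPolynomial.X (Sum.inr k)

theorem eval_rename_inl {n : ℕ} (f : MvPolynomial (Fin (n + 1)) ℂ)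
    (a : Fin (n + 1) ⊕ Fin (n + 1) → ℂ) :
    MvPolynomial.eval a (MvPolynomial.rename Sum.inl f) = MvPolynomial.eval (a ∘ Sum.inl) f :=
  MvPolynomial.eval_rename _ _ _

theorem image_eval_gradientRows {n : ℕ} (I : Ideal (MvPolynomial (Fin (n + 1)) ℂ))
    (a : Fin (n + 1) ⊕ Fin (n + 1) → ℂ) :
    (fun R k => MvPolynomial.eval a (R k)) '' gradientRows I =
      (gradientSpace I (a ∘ Sum.inl) : Set (Fin (n + 1) → ℂ)) := by
  rw [gradientRows, Set.image_image]
  simp only [eval_rename_inl]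
  rfl

theorem exists_minorSet_gradientRows_iff {n : ℕ} (I : Ideal (MvPolynomial (Fin (n + 1)) ℂ))
    (r : ℕ) (a : Fin (n + 1) ⊕ Fin (n + 1) → ℂ) :
    (∃ g ∈ minorSet (gradientRows I) r, MvPolynomial.eval a g ≠ 0) ↔
      r ≤ Module.finrank ℂ (gradientSpace I (a ∘ Sum.inl)) := by
  rw [exists_minorSet_eval_ne_zero_iff, image_eval_gradientRows, Submodule.span_eq]

/-- Rank at most `r` is the vanishing of the minors of size `r + 1`. With the nonvanishing of an
`r`-minor of the gradients alone, this makes the conormal condition locally closed. -/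
theorem forall_minorSet_eval_eq_zero_iff {n : ℕ} (I : Ideal (MvPolynomial (Fin (n + 1)) ℂ))
    (r : ℕ) (a : Fin (n + 1) ⊕ Fin (n + 1) → ℂ) :
    (∀ g ∈ minorSet (gradientRows I ∪ {dualRow n}) (r + 1), MvPolynomial.eval a g = 0) ↔
      Module.finrank ℂ (gradientSpace I (a ∘ Sum.inl) ⊔ Submodule.span ℂ {a ∘ Sum.inr} :
        Submodule ℂ (Fin (n + 1) → ℂ)) ≤ r := by
  have h := exists_minorSet_eval_ne_zero_iff (gradientRows I ∪ {dualRow n}) (r + 1) a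
  have hrow : (fun k => MvPolynomial.eval a (dualRow n k)) = a ∘ Sum.inr := by
    funext k
    simp [dualRow]
  rw [Set.image_union, image_eval_gradientRows, Set.image_singleton, hrow, Submodule.span_union,
    Submodule.span_eq] at h
  rw [← not_lt, ← Nat.succ_le_iff, ← h]
  push Not
  rfl

/-! ### The Euclidean topology of projective space -/

/-- The saturation of an open set under scaling is a union of open sets, one for each unit. Openness
lets closures in projective space be computed on coordinate vectors, where sequences suffice. -/
theorem isOpenQuotientMap_projectivization_mk' (n : ℕ) :
    IsOpenQuotientMap (Projectivization.mk' ℂ (V := CoordSpace n)) where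
  surjective := Quotient.mk_surjective
  continuous := continuous_coinduced_rng
  isOpenMap := by
    intro O hO
    rw [isOpen_coinduced]
    have h1 : (Projectivization.mk' ℂ (V := CoordSpace n)) ⁻¹' (Projectivization.mk' ℂ '' O) =
        ⋃ c : ℂˣ, (fun v : {v : CoordSpace n // v ≠ 0} =>
          (⟨c • (v : CoordSpace n), (smul_ne_zero_iff_ne c).2 v.2⟩ :
            {v : CoordSpace n // v ≠ 0})) ⁻¹' O := by
      ext v
      simp only [Set.mem_preimage, Set.mem_image, Set.mem_iUnion]
      constructor
      · rintro ⟨w, hw, hwv⟩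
        obtain ⟨c, hc⟩ := (Projectivization.mk_eq_mk_iff ℂ _ _ w.2 v.2).1 hwv
        refine ⟨c, ?_⟩
        convert hw
      · rintro ⟨c, hc⟩
        exact ⟨_, hc, (Projectivization.mk_eq_mk_iff ℂ _ _ _ v.2).2 ⟨c, rfl⟩⟩
    rw [h1]
    refine isOpen_iUnion fun c => hO.preimage ?_
    exact Continuous.subtype_mk (continuous_subtype_val.const_smul c) _

theorem tendsto_projectivization_mk {n : ℕ} {ι : Type*} {F : Filter ι} {v : ι → CoordSpace n}
    {v₀ : CoordSpace n} (hv : ∀ k, v k ≠ 0) (hv₀ : v₀ ≠ 0) (h : Tendsto v F (𝓝 v₀)) :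
    Tendsto (fun k => Projectivization.mk ℂ (v k) (hv k)) F
      (𝓝 (Projectivization.mk ℂ v₀ hv₀)) := by
  have h1 : Tendsto (fun k => (⟨v k, hv k⟩ : {v : CoordSpace n // v ≠ 0})) F (𝓝 ⟨v₀, hv₀⟩) :=
    tendsto_subtype_rng.2 h
  exact ((isOpenQuotientMap_projectivization_mk' n).continuous.tendsto _).comp h1

/-- Points in the closure of a subset of `ℙⁿ × ℙⁿ` are limits of sequences of coordinate vectors. -/
theorem exists_seq_tendsto_of_mk_mem_closure {n : ℕ} {N : Set (ProjSpace n × ProjSpace n)}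
    {v l : CoordSpace n} (hv : v ≠ 0) (hl : l ≠ 0)
    (h : (Projectivization.mk ℂ v hv, Projectivization.mk ℂ l hl) ∈ closure N) :
    ∃ (a b : ℕ → CoordSpace n) (ha : ∀ k, a k ≠ 0) (hb : ∀ k, b k ≠ 0),
      (∀ k, (Projectivization.mk ℂ (a k) (ha k), Projectivization.mk ℂ (b k) (hb k)) ∈ N) ∧
      Tendsto a atTop (𝓝 v) ∧ Tendsto b atTop (𝓝 l) := by
  have hq := (isOpenQuotientMap_projectivization_mk' n).prodMap
    (isOpenQuotientMap_projectivization_mk' n)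
  have h1 : ((⟨v, hv⟩, ⟨l, hl⟩) : {v : CoordSpace n // v ≠ 0} × {v : CoordSpace n // v ≠ 0}) ∈
      closure (Prod.map (Projectivization.mk' ℂ) (Projectivization.mk' ℂ) ⁻¹' N) := by
    rw [← hq.isOpenMap.preimage_closure_eq_closure_preimage hq.continuous]
    exact h
  obtain ⟨x, hx, hlim⟩ := mem_closure_iff_seq_limit.1 h1
  refine ⟨fun k => (x k).1, fun k => (x k).2, fun k => (x k).1.2, fun k => (x k).2.2, hx, ?_, ?_⟩
  · exact (continuous_subtype_val.tendsto _).comp ((continuous_fst.tendsto _).comp hlim)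
  · exact (continuous_subtype_val.tendsto _).comp ((continuous_snd.tendsto _).comp hlim)

theorem mk_mem_closure_of_tendsto {n : ℕ} {N : Set (ProjSpace n × ProjSpace n)}
    {v l : CoordSpace n} (hv : v ≠ 0) (hl : l ≠ 0) {a b : ℕ → CoordSpace n}
    (ha : Tendsto a atTop (𝓝 v)) (hb : Tendsto b atTop (𝓝 l))
    (h : ∀ k (hak : a k ≠ 0) (hbk : b k ≠ 0),
      (Projectivization.mk ℂ (a k) hak, Projectivization.mk ℂ (b k) hbk) ∈ N) :
    (Projectivization.mk ℂ v hv, Projectivization.mk ℂ l hl) ∈ closure N := by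
  obtain ⟨K, hK⟩ := eventually_atTop.1 ((ha.eventually_ne hv).and (hb.eventually_ne hl))
  have hK' : ∀ k, a (k + K) ≠ 0 ∧ b (k + K) ≠ 0 := fun k => hK _ (Nat.le_add_left _ _)
  refine mem_closure_of_tendsto (f := fun k => (Projectivization.mk ℂ (a (k + K)) (hK' k).1,
    Projectivization.mk ℂ (b (k + K)) (hK' k).2)) (b := atTop) ?_
    (Eventually.of_forall fun k => h _ _ _)
  exact (tendsto_projectivization_mk _ hv ((tendsto_add_atTop_iff_nat K).2 ha)).prodMk_nhds
    (tendsto_projectivization_mk _ hl ((tendsto_add_atTop_iff_nat K).2 hb))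

/-! ### Vanishing ideals -/

theorem mem_homogIdeal_iff {n : ℕ} {W : Set (ProjSpace n)} {f : MvPolynomial (Fin (n + 1)) ℂ} :
    f ∈ homogIdeal W ↔ ∀ (v : CoordSpace n) (hv : v ≠ 0), Projectivization.mk ℂ v hv ∈ W →
      MvPolynomial.eval v.ofLp f = 0 := by
  constructor
  · intro hf v hv hvW
    have := hf _ ⟨v, hv, hvW, rfl⟩
    rwa [MvPolynomial.aeval_eq_eval] at this
  · rintro hf _ ⟨v, hv, hvW, rfl⟩
    rw [MvPolynomial.aeval_eq_eval]
    exact hf v hv hvW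

theorem mem_bihomogIdeal_iff {n : ℕ} {A : Set (ProjSpace n × ProjSpace n)} {f : BiPoly n} :
    f ∈ bihomogIdeal A ↔ ∀ (v l : CoordSpace n) (hv : v ≠ 0) (hl : l ≠ 0),
      (Projectivization.mk ℂ v hv, Projectivization.mk ℂ l hl) ∈ A →
        MvPolynomial.eval (Sum.elim v.ofLp l.ofLp) f = 0 := by
  constructor
  · intro hf v l hv hl hvl
    have := hf _ ⟨v, l, hv, hl, hvl, rfl⟩
    rwa [MvPolynomial.aeval_eq_eval] at this
  · rintro hf _ ⟨v, l, hv, hl, hvl, rfl⟩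
    rw [MvPolynomial.aeval_eq_eval]
    exact hf v l hv hl hvl

theorem continuous_eval_sumElim {n : ℕ} (f : BiPoly n) :
    Continuous fun x : CoordSpace n × CoordSpace n =>
      MvPolynomial.eval (Sum.elim x.1.ofLp x.2.ofLp) f := by
  refine (MvPolynomial.continuous_eval f).comp (continuous_pi fun i => ?_)
  rcases i with i | i
  · exact (EuclideanSpace.proj (𝕜 := ℂ) i).continuous.comp continuous_fst
  · exact (EuclideanSpace.proj (𝕜 := ℂ) i).continuous.comp continuous_snd

theorem bihomogIdeal_closure {n : ℕ} (N : Set (ProjSpace n × ProjSpace n)) :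
    bihomogIdeal (closure N) = bihomogIdeal N := by
  ext f
  rw [mem_bihomogIdeal_iff, mem_bihomogIdeal_iff]
  refine ⟨fun h v l hv hl hvl => h v l hv hl (subset_closure hvl), fun h v l hv hl hvl => ?_⟩
  obtain ⟨a, b, ha, hb, hab, hav, hbl⟩ := exists_seq_tendsto_of_mk_mem_closure hv hl hvl
  refine tendsto_nhds_unique
    (((continuous_eval_sumElim f).tendsto (v, l)).comp (hav.prodMk_nhds hbl))
    (tendsto_const_nhds.congr fun k => (h _ _ (ha k) (hb k) (hab k)).symm)

theorem eval_smul_of_isHomogeneous {σ : Type*} [Fintype σ] {f : MvPolynomial σ ℂ} {d : ℕ}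
    (hf : f.IsHomogeneous d) (c : ℂ) (a : σ → ℂ) :
    MvPolynomial.eval (c • a) f = c ^ d * MvPolynomial.eval a f := by
  rw [MvPolynomial.eval_eq', MvPolynomial.eval_eq', Finset.mul_sum]
  refine Finset.sum_congr rfl fun m hm => ?_
  have hd : ∑ i, m i = d := by
    have := hf (MvPolynomial.mem_support_iff.1 hm)
    simpa [Finsupp.weight_apply, Finsupp.sum_fintype] using this
  simp only [Pi.smul_apply, smul_eq_mul, mul_pow, Finset.prod_mul_distrib,
    Finset.prod_pow_eq_pow_sum, hd]
  ring

/-- At a fixed `v` in the cone, `f(c v)` is a polynomial in `c` that vanishes for all `c ≠ 0`; its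
coefficients are the values of the homogeneous components. -/
theorem homogeneousComponent_mem_homogIdeal {n : ℕ} {W : Set (ProjSpace n)}
    {f : MvPolynomial (Fin (n + 1)) ℂ} (hf : f ∈ homogIdeal W) (d : ℕ) :
    MvPolynomial.homogeneousComponent d f ∈ homogIdeal W := by
  rw [mem_homogIdeal_iff] at hf ⊢
  intro v hv hvW
  let F : Polynomial ℂ := ∑ i ∈ Finset.range (f.totalDegree + 1), Polynomial.C
    (MvPolynomial.eval v.ofLp (MvPolynomial.homogeneousComponent i f)) * Polynomial.X ^ i
  have hF : ∀ c : ℂ, F.eval c = MvPolynomial.eval (c • v.ofLp) f := by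
    intro c
    conv_rhs => rw [← MvPolynomial.sum_homogeneousComponent f]
    rw [map_sum, Polynomial.eval_finsetSum]
    refine Finset.sum_congr rfl fun i _ => ?_
    rw [eval_smul_of_isHomogeneous (MvPolynomial.homogeneousComponent_isHomogeneous i f)]
    rw [Polynomial.eval_mul, Polynomial.eval_C, Polynomial.eval_pow, Polynomial.eval_X, mul_comm]
  have hF0 : F = 0 := by
    refine Polynomial.eq_zero_of_infinite_isRoot F (Set.Infinite.mono (s := {0}ᶜ) ?_
      (Set.finite_singleton (0 : ℂ)).infinite_compl)
    intro c hc
    change F.eval c = 0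
    rw [hF]
    refine hf (c • v) (smul_ne_zero hc hv) ?_
    rwa [(Projectivization.mk_eq_mk_iff' ℂ _ _ (smul_ne_zero hc hv) hv).2 ⟨c, rfl⟩]
  by_cases hd : d ∈ Finset.range (f.totalDegree + 1)
  · have h1 := congrArg (fun p => Polynomial.coeff p d) hF0
    simp only [F, Polynomial.finsetSum_coeff, Polynomial.coeff_C_mul_X_pow,
      Polynomial.coeff_zero, Finset.sum_ite_eq, hd, if_true] at h1
    exact h1
  · rw [MvPolynomial.homogeneousComponent_eq_zero, map_zero]
    simpa using hd

/-- Zariski closed sets, in terms of arbitrary homogeneous coordinates. -/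
theorem IsZariskiClosed.exists_forall_mk_mem_iff {n : ℕ} {Z : Set (ProjSpace n)}
    (hZ : IsZariskiClosed Z) :
    ∃ S ⊆ (homogIdeal Z : Set (MvPolynomial (Fin (n + 1)) ℂ)), ∀ (v : CoordSpace n) (hv : v ≠ 0),
      Projectivization.mk ℂ v hv ∈ Z ↔ ∀ f ∈ S, MvPolynomial.eval v.ofLp f = 0 := by
  obtain ⟨S, hS, hmem⟩ := hZ
  have h1 : ∀ (v : CoordSpace n) (hv : v ≠ 0),
      Projectivization.mk ℂ v hv ∈ Z ↔ ∀ f ∈ S, MvPolynomial.eval v.ofLp f = 0 := by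
    intro v hv
    rw [hmem]
    obtain ⟨c, hc⟩ := Projectivization.exists_smul_eq_mk_rep ℂ v hv
    have h2 : (Projectivization.mk ℂ v hv).rep.ofLp = (c : ℂ) • v.ofLp := by
      rw [← hc]
      rfl
    refine forall₂_congr fun f hf => ?_
    obtain ⟨d, hd⟩ := hS f hf
    rw [h2, eval_smul_of_isHomogeneous hd, mul_eq_zero, or_iff_right (pow_ne_zero _ c.ne_zero)]
  exact ⟨S, fun f hf => mem_homogIdeal_iff.2 fun v hv hvZ => (h1 v hv).1 hvZ f hf, h1⟩

theorem IsZariskiClosed.mk_mem_iff {n : ℕ} {Z : Set (ProjSpace n)} (hZ : IsZariskiClosed Z)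
    {v : CoordSpace n} (hv : v ≠ 0) : Projectivization.mk ℂ v hv ∈ Z ↔
      ∀ f ∈ homogIdeal Z, MvPolynomial.eval v.ofLp f = 0 := by
  obtain ⟨S, hS, hmem⟩ := hZ.exists_forall_mk_mem_iff
  exact ⟨fun h f hf => mem_homogIdeal_iff.1 hf v hv h,
    fun h => (hmem v hv).2 fun f hf => h f (hS hf)⟩

theorem IsZariskiClosed.inter {n : ℕ} {Z Z' : Set (ProjSpace n)} (hZ : IsZariskiClosed Z)
    (hZ' : IsZariskiClosed Z') : IsZariskiClosed (Z ∩ Z') := by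
  obtain ⟨S, hS, hmem⟩ := hZ
  obtain ⟨S', hS', hmem'⟩ := hZ'
  refine ⟨S ∪ S', fun f hf => hf.elim (hS f) (hS' f), fun x => ?_⟩
  rw [Set.mem_inter_iff, hmem, hmem']
  simp only [Set.mem_union, or_imp, forall_and]

/-- `Y` is covered by `Z` and the zero set `A` of the homogeneous elements of `I(U)`. As `U` is
nonempty, irreducibility leaves only `Y ⊆ A`. -/
theorem homogIdeal_eq_of_isZariskiOpenIn {n : ℕ} {U Y : Set (ProjSpace n)}
    (hY : IsIrreducibleVariety Y) (hU : IsZariskiOpenIn U Y) (hne : U.Nonempty) :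
    homogIdeal U = homogIdeal Y := by
  obtain ⟨Z, hZ, rfl⟩ := hU
  refine le_antisymm (fun f hf => ?_) fun f hf => mem_homogIdeal_iff.2 fun v hv hvU =>
    mem_homogIdeal_iff.1 hf v hv hvU.1
  let A : Set (ProjSpace n) := {x | ∀ g : MvPolynomial (Fin (n + 1)) ℂ,
    g ∈ homogIdeal (Y \ Z) ∧ (∃ d, g.IsHomogeneous d) → MvPolynomial.eval x.rep.ofLp g = 0}
  have hA : IsZariskiClosed A :=
    ⟨{g | g ∈ homogIdeal (Y \ Z) ∧ ∃ d, g.IsHomogeneous d}, fun g hg => hg.2, fun x => Iff.rfl⟩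
  have hYA : Y ⊆ A ∪ Z := by
    intro x hx
    by_cases hxZ : x ∈ Z
    · exact Or.inr hxZ
    · refine Or.inl fun g hg => mem_homogIdeal_iff.1 hg.1 x.rep x.rep_nonzero ?_
      rw [Projectivization.mk_rep]
      exact ⟨hx, hxZ⟩
  rcases hY.2.2 A Z hA hZ hYA with h | h
  · rw [mem_homogIdeal_iff]
    intro v hv hvY
    obtain ⟨c, hc⟩ := Projectivization.exists_smul_eq_mk_rep ℂ v hv
    have h2 : (Projectivization.mk ℂ v hv).rep.ofLp = (c : ℂ) • v.ofLp := by
      rw [← hc]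
      rfl
    rw [← MvPolynomial.sum_homogeneousComponent f, map_sum]
    refine Finset.sum_eq_zero fun i _ => ?_
    have hi := MvPolynomial.homogeneousComponent_isHomogeneous i f
    have h3 := h hvY _ ⟨homogeneousComponent_mem_homogIdeal hf i, i, hi⟩
    rw [h2, eval_smul_of_isHomogeneous hi] at h3
    exact (mul_eq_zero.1 h3).resolve_left (pow_ne_zero _ c.ne_zero)
  · obtain ⟨x, hx⟩ := hne
    exact absurd (h hx.1) hx.2

theorem subset_regPoints_of_isZariskiOpenIn {n : ℕ} {U Y : Set (ProjSpace n)}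
    (hY : IsIrreducibleVariety Y) (hU : IsZariskiOpenIn U Y) (hUreg : U ⊆ regPoints Y) :
    U ⊆ regPoints U := by
  intro x hx
  have hI := homogIdeal_eq_of_isZariskiOpenIn hY hU ⟨x, hx⟩
  have hT : tangentSpaceAt U x = tangentSpaceAt Y x := by
    ext w
    change (∀ f ∈ homogIdeal U, _) ↔ ∀ f ∈ homogIdeal Y, _
    rw [hI]
  refine ⟨hx, ?_⟩
  rw [hI, hT]
  exact (hUreg hx).2

/-! ### Conormal spaces and their vanishing ideals -/

/-- The Krull dimension fixes `r`, so the same minors vanish at all conormal pairs. -/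
theorem minorSet_subset_bihomogIdeal {n : ℕ} {W : Set (ProjSpace n)} {d r : ℕ}
    (hdr : d + r = n + 1)
    (hd : ringKrullDim (MvPolynomial (Fin (n + 1)) ℂ ⧸ homogIdeal W) = (d : WithBot ℕ∞)) :
    minorSet (gradientRows (homogIdeal W) ∪ {dualRow n}) (r + 1) ⊆
      (bihomogIdeal (conormalPairs W) : Set (BiPoly n)) := by
  intro g hg
  refine mem_bihomogIdeal_iff.2 fun v l hv hl hvl => ?_
  obtain ⟨-, d', r', hdr', hd', -, hr2⟩ := (mk_mem_conormalPairs_iff W hv hl).1 hvl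
  rw [hd] at hd'
  have hdd : d = d' := by exact_mod_cast hd'
  have hrr : r' = r := by omega
  rw [hrr] at hr2
  exact (forall_minorSet_eval_eq_zero_iff _ _ (Sum.elim v.ofLp l.ofLp)).2 hr2 g hg

/-- Over the regular locus the conormal pairs are Zariski closed. -/
theorem mk_mem_conormalPairs_of_eval_eq_zero {n : ℕ} {W : Set (ProjSpace n)}
    {v l : CoordSpace n} (hv : v ≠ 0) (hl : l ≠ 0)
    (hreg : Projectivization.mk ℂ v hv ∈ regPoints W)
    (h : ∀ f ∈ bihomogIdeal (conormalSpace W),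
      MvPolynomial.eval (Sum.elim v.ofLp l.ofLp) f = 0) :
    (Projectivization.mk ℂ v hv, Projectivization.mk ℂ l hl) ∈ conormalPairs W := by
  obtain ⟨hfin, -⟩ := finrank_add_finrank_of_mem_iff _ _ (mem_tangentSpaceAt_mk W hv)
  rw [conormalSpace, bihomogIdeal_closure] at h
  have hdr : Module.finrank ℂ (tangentSpaceAt W (Projectivization.mk ℂ v hv)) +
      Module.finrank ℂ (gradientSpace (homogIdeal W) v.ofLp) = n + 1 := by
    rw [add_comm]
    exact hfin
  refine (mk_mem_conormalPairs_iff W hv hl).2 ⟨hreg.1, _, _, hdr, hreg.2, le_rfl, ?_⟩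
  exact (forall_minorSet_eval_eq_zero_iff _ _ (Sum.elim v.ofLp l.ofLp)).1
    fun g hg => h g (minorSet_subset_bihomogIdeal hdr hreg.2 hg)

/-- The conormal space of a closed variety is Zariski closed. -/
theorem mk_mem_conormalSpace_of_eval_eq_zero {n : ℕ} {X : Set (ProjSpace n)}
    (hX : IsZariskiClosed X) {v l : CoordSpace n} (hv : v ≠ 0) (hl : l ≠ 0)
    (h : ∀ f ∈ bihomogIdeal (conormalSpace X),
      MvPolynomial.eval (Sum.elim v.ofLp l.ofLp) f = 0) :
    (Projectivization.mk ℂ v hv, Projectivization.mk ℂ l hl) ∈ conormalSpace X := by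
  rw [conormalSpace, bihomogIdeal_closure] at h
  -- Without such `d` and `r` there are no conormal pairs, so the constant `1` lies in the ideal and
  -- cannot vanish.
  by_cases hdr : ∃ d r : ℕ, d + r = n + 1 ∧
    ringKrullDim (MvPolynomial (Fin (n + 1)) ℂ ⧸ homogIdeal X) = (d : WithBot ℕ∞)
  swap
  · have h1 := h 1 (mem_bihomogIdeal_iff.2 fun a b ha hb hab => by
      obtain ⟨-, d, r, h1, h2, -⟩ := (mk_mem_conormalPairs_iff X ha hb).1 hab
      exact absurd ⟨d, r, h1, h2⟩ hdr)
    simp at h1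
  obtain ⟨d, r, hdr, hd⟩ := hdr
  -- The conormal pairs as a locally closed set: the equations `E` put the point on `X` and bound
  -- the rank above, while `G` bounds the rank of the gradients below.
  let E : Set (BiPoly n) := MvPolynomial.rename Sum.inl '' (homogIdeal X : Set _) ∪
    minorSet (gradientRows (homogIdeal X) ∪ {dualRow n}) (r + 1)
  let G : Set (BiPoly n) := minorSet (gradientRows (homogIdeal X)) r
  have key : ∀ (a b : CoordSpace n) (ha : a ≠ 0) (hb : b ≠ 0),
      (∀ e ∈ E, MvPolynomial.eval (Sum.elim a.ofLp b.ofLp) e = 0) →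
      (∃ g ∈ G, MvPolynomial.eval (Sum.elim a.ofLp b.ofLp) g ≠ 0) →
      (Projectivization.mk ℂ a ha, Projectivization.mk ℂ b hb) ∈ conormalPairs X := by
    intro a b ha hb hE hG
    refine (mk_mem_conormalPairs_iff X ha hb).2 ⟨(hX.mk_mem_iff ha).2 fun f hf => ?_,
      d, r, hdr, hd,
      (exists_minorSet_gradientRows_iff _ _ (Sum.elim a.ofLp b.ofLp)).1 hG,
      (forall_minorSet_eval_eq_zero_iff _ _ (Sum.elim a.ofLp b.ofLp)).1
        fun g hg => hE g (Or.inr hg)⟩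
    have := hE _ (Or.inl ⟨f, hf, rfl⟩)
    rwa [eval_rename_inl] at this
  have hmem := mem_closure_of_vanishingIdeal_le E G (p := Sum.elim v.ofLp l.ofLp) (by
    intro f hf
    refine h f (mem_bihomogIdeal_iff.2 fun a b ha hb hab => hf _ ?_ ?_)
    · rintro e (⟨e', he', rfl⟩ | he)
      · rw [eval_rename_inl]
        exact mem_homogIdeal_iff.1 he' a ha ((mk_mem_conormalPairs_iff X ha hb).1 hab).1
      · exact mem_bihomogIdeal_iff.1 (minorSet_subset_bihomogIdeal hdr hd he) a b ha hb hab
    · obtain ⟨-, d', r', hdr', hd', hr1, -⟩ := (mk_mem_conormalPairs_iff X ha hb).1 hab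
      rw [hd] at hd'
      have hdd : d = d' := by exact_mod_cast hd'
      have hrr : r' = r := by omega
      rw [hrr] at hr1
      exact (exists_minorSet_gradientRows_iff _ _ (Sum.elim a.ofLp b.ofLp)).2 hr1)
  obtain ⟨q, hq, hlim⟩ := mem_closure_iff_seq_limit.1 hmem
  have hlim' := tendsto_pi_nhds.1 hlim
  have hto : ∀ {ι : Type} (u : ι → CoordSpace n) (F : Filter ι) (w : CoordSpace n),
      (∀ i, Tendsto (fun k => (u k).ofLp i) F (𝓝 (w.ofLp i))) → Tendsto u F (𝓝 w) :=
    fun u F w hu => ((PiLp.continuous_toLp 2 _).tendsto w.ofLp).comp (tendsto_pi_nhds.2 hu)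
  refine mk_mem_closure_of_tendsto hv hl
    (a := fun k => WithLp.toLp 2 (q k ∘ Sum.inl)) (b := fun k => WithLp.toLp 2 (q k ∘ Sum.inr))
    (hto _ _ _ fun i => hlim' (Sum.inl i)) (hto _ _ _ fun i => hlim' (Sum.inr i))
    fun k ha hb => key _ _ ha hb ?_ ?_
  · have := (hq k).1
    rwa [← Sum.elim_comp_inl_inr (q k)] at this
  · have := (hq k).2
    rwa [← Sum.elim_comp_inl_inr (q k)] at this

/-- Taking the closure adds nothing over `U`: at regular points the conormal condition is given by
equations, which persist in limits. -/
theorem conormalSpace_inter_fiber_subset {n : ℕ} {U : Set (ProjSpace n)}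
    (hU : U ⊆ regPoints U) {p : ProjSpace n × ProjSpace n} (hp : p ∈ conormalSpace U)
    (hpU : p.1 ∈ U) : p ∈ conormalPairs U := by
  obtain ⟨x, l⟩ := p
  induction x using Projectivization.ind with | h v hv =>
  induction l using Projectivization.ind with | h l hl =>
  exact mk_mem_conormalPairs_of_eval_eq_zero hv hl (hU hpU)
    fun f hf => mem_bihomogIdeal_iff.1 hf v l hv hl hp

theorem mem_conormalPreimage_iff {n : ℕ} {X U : Set (ProjSpace n)}
    {p : ProjSpace n × ProjSpace n} :
    p ∈ conormalPreimage X U ↔ p ∈ conormalSpace X ∧ p.1 ∈ U := by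
  constructor
  · rintro ⟨⟨q, hq⟩, hqU, rfl⟩
    exact ⟨hq, hqU⟩
  · rintro ⟨hp, hpU⟩
    exact ⟨⟨p, hp⟩, hpU, rfl⟩

/-! ### Saturated ideals and zero sets -/

theorem mem_saturation_iff {R : Type*} [CommRing R] {J B : Ideal R} {f : R} :
    f ∈ saturation J B ↔ ∃ k : ℕ, ∀ b ∈ B ^ k, f * b ∈ J := by
  have hmono : ∀ {i j : ℕ}, i ≤ j →
      Submodule.colon J ((B ^ i : Ideal R) : Set R) ≤ Submodule.colon J ((B ^ j : Ideal R) : Set R) :=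
    fun hij => Submodule.colon_mono le_rfl (Ideal.pow_le_pow_right hij)
  rw [saturation, Submodule.mem_iSup_of_directed _ fun i j =>
    ⟨max i j, hmono (le_max_left i j), hmono (le_max_right i j)⟩]
  exact exists_congr fun k => Submodule.mem_colon

theorem eval_eq_zero_of_mem_radical_saturation {σ : Type*} {J B : Ideal (MvPolynomial σ ℂ)}
    {f : MvPolynomial σ ℂ} (hf : f ∈ (saturation J B).radical) {a : σ → ℂ}
    (hJ : ∀ g ∈ J, MvPolynomial.eval a g = 0) (hB : ∃ b ∈ B, MvPolynomial.eval a b ≠ 0) :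
    MvPolynomial.eval a f = 0 := by
  obtain ⟨m, hm⟩ := hf
  obtain ⟨k, hk⟩ := mem_saturation_iff.1 hm
  obtain ⟨b, hb, hba⟩ := hB
  have h1 := hJ _ (hk _ (Ideal.pow_mem_pow hb k))
  rw [map_mul, map_pow, map_pow] at h1
  exact eq_zero_of_pow_eq_zero ((mul_eq_zero.1 h1).resolve_right (pow_ne_zero _ hba))

/-- By the Nullstellensatz `f B` lies in the radical of `J`. As the ideal is finitely generated,
some power of `f B` lies in `J`, so `f ^ k` multiplies `B ^ k` into `J`. -/
theorem mem_radical_saturation_of_eval {σ : Type*} [Finite σ] {J B : Ideal (MvPolynomial σ ℂ)}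
    {f : MvPolynomial σ ℂ} (h : ∀ a : σ → ℂ, (∀ g ∈ J, MvPolynomial.eval a g = 0) →
      (∃ b ∈ B, MvPolynomial.eval a b ≠ 0) → MvPolynomial.eval a f = 0) :
    f ∈ (saturation J B).radical := by
  have h1 : Ideal.span {f} * B ≤ J.radical := by
    rw [← MvPolynomial.vanishingIdeal_zeroLocus_eq_radical (K := ℂ), Ideal.span_singleton_mul_le_iff]
    intro b hb a ha
    have haJ : ∀ g ∈ J, MvPolynomial.eval a g = 0 := fun g hg => by
      have := ha g hg
      rwa [MvPolynomial.aeval_eq_eval] at this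
    rw [MvPolynomial.aeval_eq_eval, map_mul, mul_eq_zero]
    by_cases hba : MvPolynomial.eval a b = 0
    · exact Or.inr hba
    · exact Or.inl (h a haJ ⟨b, hb, hba⟩)
  obtain ⟨k, hk⟩ := Ideal.exists_pow_le_of_le_radical_of_fg h1 (IsNoetherian.noetherian _)
  refine ⟨k, mem_saturation_iff.2 ⟨k, fun b hb => hk ?_⟩⟩
  rw [mul_pow]
  exact Ideal.mul_mem_mul (Ideal.pow_mem_pow (Ideal.mem_span_singleton_self f) k) hb

theorem exists_mem_irrelevantIdeal_eval_ne_zero_iff {n : ℕ} (a : Fin (n + 1) ⊕ Fin (n + 1) → ℂ) :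
    (∃ b ∈ irrelevantIdeal n, MvPolynomial.eval a b ≠ 0) ↔
      a ∘ Sum.inl ≠ 0 ∧ a ∘ Sum.inr ≠ 0 := by
  constructor
  · rintro ⟨b, hb, hba⟩
    by_contra hc
    have : irrelevantIdeal n ≤ RingHom.ker (MvPolynomial.eval a) := by
      refine Ideal.span_le.2 ?_
      rintro _ ⟨i, j, rfl⟩
      change MvPolynomial.eval a _ = 0
      rw [map_mul, MvPolynomial.eval_X, MvPolynomial.eval_X, mul_eq_zero]
      rcases not_and_or.1 hc with h | h
      · exact Or.inl (congrFun (not_not.1 h) i)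
      · exact Or.inr (congrFun (not_not.1 h) j)
    exact hba (this hb)
  · rintro ⟨h1, h2⟩
    obtain ⟨i, hi⟩ := Function.ne_iff.1 h1
    obtain ⟨j, hj⟩ := Function.ne_iff.1 h2
    refine ⟨_, Ideal.subset_span ⟨i, j, rfl⟩, ?_⟩
    rw [map_mul, MvPolynomial.eval_X, MvPolynomial.eval_X]
    exact mul_ne_zero hi hj

theorem forall_mem_extendedIdeal_iff {n : ℕ} (W : Set (ProjSpace n))
    (a : Fin (n + 1) ⊕ Fin (n + 1) → ℂ) :
    (∀ f ∈ extendedIdeal W, MvPolynomial.eval a f = 0) ↔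
      ∀ f ∈ homogIdeal W, MvPolynomial.eval (a ∘ Sum.inl) f = 0 := by
  constructor
  · intro h f hf
    rw [← eval_rename_inl]
    exact h _ (Ideal.mem_map_of_mem _ hf)
  · intro h
    have : extendedIdeal W ≤ RingHom.ker (MvPolynomial.eval a) := by
      refine Ideal.map_le_iff_le_comap.2 fun f hf => ?_
      change MvPolynomial.eval a (MvPolynomial.rename Sum.inl f) = 0
      rw [eval_rename_inl]
      exact h f hf
    exact fun f hf => this hf

theorem forall_mem_sup_eval_eq_zero_iff {σ : Type*} (I J : Ideal (MvPolynomial σ ℂ)) (a : σ → ℂ) :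
    (∀ f ∈ I ⊔ J, MvPolynomial.eval a f = 0) ↔
      (∀ f ∈ I, MvPolynomial.eval a f = 0) ∧ ∀ f ∈ J, MvPolynomial.eval a f = 0 :=
  sup_le_iff (a := I) (b := J) (c := RingHom.ker (MvPolynomial.eval a))

theorem exists_mem_mul_eval_ne_zero_iff {σ : Type*} (I J : Ideal (MvPolynomial σ ℂ)) (a : σ → ℂ) :
    (∃ f ∈ I * J, MvPolynomial.eval a f ≠ 0) ↔
      (∃ f ∈ I, MvPolynomial.eval a f ≠ 0) ∧ ∃ f ∈ J, MvPolynomial.eval a f ≠ 0 := by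
  constructor
  · rintro ⟨f, hf, hfa⟩
    have hf' : f ∈ I ⊓ J := Ideal.mul_le_inf hf
    exact ⟨⟨f, hf'.1, hfa⟩, f, hf'.2, hfa⟩
  · rintro ⟨⟨f, hf, hfa⟩, g, hg, hga⟩
    exact ⟨f * g, Ideal.mul_mem_mul hf hg, by rw [map_mul]; exact mul_ne_zero hfa hga⟩

/-- `κ_X⁻¹(U)` in homogeneous coordinates: the zeros of `I_{C(X)} + I_Y` off `V(I_{Y \ U} 𝔟)`. -/
theorem conormalPreimage_coordinates_iff {n : ℕ} {X Y U : Set (ProjSpace n)}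
    (hX : IsZariskiClosed X) (hY : IsZariskiClosed Y) (hU : IsZariskiOpenIn U Y)
    {v l : CoordSpace n} (hv : v ≠ 0) (hl : l ≠ 0) :
    ((∀ f ∈ bihomogIdeal (conormalSpace X) ⊔ extendedIdeal Y,
        MvPolynomial.eval (Sum.elim v.ofLp l.ofLp) f = 0) ∧
      ∃ b ∈ extendedIdeal (Y \ U) * irrelevantIdeal n,
        MvPolynomial.eval (Sum.elim v.ofLp l.ofLp) b ≠ 0) ↔
      (Projectivization.mk ℂ v hv, Projectivization.mk ℂ l hl) ∈ conormalPreimage X U := by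
  obtain ⟨Z, hZ, rfl⟩ := hU
  have hYZ : Y \ (Y \ Z) = Y ∩ Z := by
    ext x
    simp
  have hirr := (exists_mem_irrelevantIdeal_eval_ne_zero_iff (Sum.elim v.ofLp l.ofLp)).2
    (by
      rw [Sum.elim_comp_inl, Sum.elim_comp_inr]
      exact ⟨fun h => hv (PiLp.ext (congrFun h)), fun h => hl (PiLp.ext (congrFun h))⟩)
  have hext : (∃ b ∈ extendedIdeal (Y ∩ Z), MvPolynomial.eval (Sum.elim v.ofLp l.ofLp) b ≠ 0) ↔
      Projectivization.mk ℂ v hv ∉ Y ∩ Z := by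
    rw [(hY.inter hZ).mk_mem_iff hv, ← not_iff_not, not_not]
    push Not
    have := forall_mem_extendedIdeal_iff (Y ∩ Z) (Sum.elim v.ofLp l.ofLp)
    rwa [Sum.elim_comp_inl] at this
  rw [mem_conormalPreimage_iff, forall_mem_sup_eval_eq_zero_iff, exists_mem_mul_eval_ne_zero_iff,
    hYZ, hext, forall_mem_extendedIdeal_iff, and_iff_left hirr, and_assoc]
  have hXiff : (∀ f ∈ bihomogIdeal (conormalSpace X),
      MvPolynomial.eval (Sum.elim v.ofLp l.ofLp) f = 0) ↔
      (Projectivization.mk ℂ v hv, Projectivization.mk ℂ l hl) ∈ conormalSpace X :=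
    ⟨mk_mem_conormalSpace_of_eval_eq_zero hX hv hl,
      fun h f hf => mem_bihomogIdeal_iff.1 hf v l hv hl h⟩
  rw [hXiff]
  refine and_congr_right fun _ => ?_
  have hYiff := hY.mk_mem_iff hv
  change (∀ f ∈ homogIdeal Y, MvPolynomial.eval v.ofLp f = 0) ∧ _ ↔ _
  rw [← hYiff]
  constructor
  · rintro ⟨h1, h2⟩
    exact ⟨h1, fun h3 => h2 ⟨h1, h3⟩⟩
  · rintro ⟨h1, h2⟩
    exact ⟨h1, fun h3 => h2 h3.2⟩

/-- For the forward direction it is enough to evaluate `I_{C(U)}` on `κ_X⁻¹(U)`: over regular points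
these equations already force the pair to be conormal. The converse needs only that points of `C(X)
∩ C(U)` satisfy both ideals. -/
theorem radical_le_radical_iff_conormalPreimage_subset {n : ℕ} {X Y U : Set (ProjSpace n)}
    (hX : IsZariskiClosed X) (hY : IsZariskiClosed Y) (hU : IsZariskiOpenIn U Y)
    (hUreg : U ⊆ regPoints U) :
    (conormalInterIdeal X U).radical ≤ (conormalPreimageIdeal X Y U).radical ↔
      conormalPreimage X U ⊆ conormalSpace X ∩ conormalSpace U := by
  constructor
  · rintro h ⟨x, l⟩ hp
    refine ⟨(mem_conormalPreimage_iff.1 hp).1, ?_⟩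
    induction x using Projectivization.ind with | h v hv =>
    induction l using Projectivization.ind with | h l hl =>
    refine subset_closure (mk_mem_conormalPairs_of_eval_eq_zero hv hl
      (hUreg (mem_conormalPreimage_iff.1 hp).2) fun f hf => ?_)
    obtain ⟨h1, h2⟩ := (conormalPreimage_coordinates_iff hX hY hU hv hl).2 hp
    refine eval_eq_zero_of_mem_radical_saturation (h (Ideal.le_radical ?_)) h1 h2
    -- Exponent `0` expresses that an ideal lies in its saturation.
    exact mem_saturation_iff.2 ⟨0, fun b _ => Ideal.mul_mem_right _ _ (Ideal.mem_sup_right hf)⟩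
  · intro h f hf
    refine mem_radical_saturation_of_eval fun a hJ hB => ?_
    obtain ⟨hv, hl⟩ := (exists_mem_irrelevantIdeal_eval_ne_zero_iff a).1
      ((exists_mem_mul_eval_ne_zero_iff _ _ _).1 hB).2
    let v : CoordSpace n := WithLp.toLp 2 (a ∘ Sum.inl)
    let l : CoordSpace n := WithLp.toLp 2 (a ∘ Sum.inr)
    have hv' : v ≠ 0 := fun h => hv (congrArg WithLp.ofLp h)
    have hl' : l ≠ 0 := fun h => hl (congrArg WithLp.ofLp h)
    have ha : Sum.elim v.ofLp l.ofLp = a := Sum.elim_comp_inl_inr a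
    rw [← ha] at hJ hB ⊢
    obtain ⟨hCX, hCU⟩ := h ((conormalPreimage_coordinates_iff hX hY hU hv' hl').1 ⟨hJ, hB⟩)
    refine eval_eq_zero_of_mem_radical_saturation hf ?_
      ((exists_mem_mul_eval_ne_zero_iff _ _ _).1 hB).2
    exact (forall_mem_sup_eval_eq_zero_iff _ _ _).2
      ⟨fun f hf => mem_bihomogIdeal_iff.1 hf v l hv' hl' hCX,
        fun f hf => mem_bihomogIdeal_iff.1 hf v l hv' hl' hCU⟩

/-! ### Whitney's condition (a) -/

/-- Conormality uses the bilinear pairing, Grassmannian limits the Hermitian one; conjugation passes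
between them. -/
theorem sum_conj_mul_eq_inner {n : ℕ} (a w : CoordSpace n) :
    ∑ i, starRingEnd ℂ (a.ofLp i) * w.ofLp i = inner ℂ a w := by
  rw [PiLp.inner_apply]
  exact Finset.sum_congr rfl fun i _ => by simp [mul_comm]

/-- Every sequence of subspaces has a convergent subsequence. -/
theorem exists_subseq_subspaceTendsto {n : ℕ} (T : ℕ → Submodule ℂ (CoordSpace n)) :
    ∃ (L : Submodule ℂ (CoordSpace n)) (u : ℕ → ℕ), StrictMono u ∧
      SubspaceTendsto (T ∘ u) L := by
  have : ProperSpace (CoordSpace n →L[ℂ] CoordSpace n) := FiniteDimensional.proper ℂ _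
  obtain ⟨Q, -, u, hu, hQ⟩ := (isCompact_closedBall
    (0 : CoordSpace n →L[ℂ] CoordSpace n) 1).tendsto_subseq
    (x := fun k => (T k).starProjection) fun k => by
      rw [mem_closedBall_zero_iff]
      exact Submodule.starProjection_norm_le _
  -- Being idempotent and self-adjoint are closed conditions, so the limit operator is again an
  -- orthogonal projection.
  have hmul : Q * Q = Q := by
    refine tendsto_nhds_unique (hQ.mul hQ) (hQ.congr fun k => ?_)
    exact ((T (u k)).isIdempotentElem_starProjection).symm
  have hstar : star Q = Q := by
    refine tendsto_nhds_unique ((continuous_star.tendsto Q).comp hQ) (hQ.congr fun k => ?_)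
    exact (isSelfAdjoint_starProjection (T (u k))).symm
  have hproj : IsStarProjection Q := ⟨hmul, hstar⟩
  obtain ⟨L, hL, rfl⟩ := isStarProjection_iff_eq_starProjection.1 hproj
  refine ⟨L, u, hu, ?_⟩
  exact hQ

theorem SubspaceTendsto.apply {n : ℕ} {T : ℕ → Submodule ℂ (CoordSpace n)}
    {L : Submodule ℂ (CoordSpace n)} (h : SubspaceTendsto T L) (w : CoordSpace n) :
    Tendsto (fun k => (T k).starProjection w) atTop (𝓝 (L.starProjection w)) :=
  ((ContinuousLinearMap.apply ℂ (CoordSpace n) w).continuous.tendsto _).comp h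

theorem tendsto_sum_mul {n : ℕ} {a b : ℕ → CoordSpace n} {a₀ b₀ : CoordSpace n}
    (ha : Tendsto a atTop (𝓝 a₀)) (hb : Tendsto b atTop (𝓝 b₀)) :
    Tendsto (fun k => ∑ i, (a k).ofLp i * (b k).ofLp i) atTop
      (𝓝 (∑ i, a₀.ofLp i * b₀.ofLp i)) :=
  tendsto_finsetSum _ fun i _ =>
    (((EuclideanSpace.proj (𝕜 := ℂ) i).continuous.tendsto _).comp ha).mul
      (((EuclideanSpace.proj (𝕜 := ℂ) i).continuous.tendsto _).comp hb)

theorem mk_mem_conormalPairs_iff_of_mem_regPoints {n : ℕ} {W : Set (ProjSpace n)}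
    {x : ProjSpace n} (hx : x ∈ regPoints W) {l : CoordSpace n} (hl : l ≠ 0) :
    (x, Projectivization.mk ℂ l hl) ∈ conormalPairs W ↔
      ∀ w ∈ tangentSpaceAt W x, ∑ i, l.ofLp i * w.ofLp i = 0 :=
  (and_iff_right hx).trans (forall₂_congr fun w _ => sum_rep_mk_mul_eq_zero_iff hl w)

theorem conormalPreimage_subset_of_whitneyA {n : ℕ} {X U : Set (ProjSpace n)}
    (hUreg : U ⊆ regPoints U) (h : WhitneyA X U) :
    conormalPreimage X U ⊆ conormalSpace X ∩ conormalSpace U := by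
  rintro ⟨y, l⟩ hp
  obtain ⟨hpX, hy⟩ := mem_conormalPreimage_iff.1 hp
  refine ⟨hpX, subset_closure ?_⟩
  induction y using Projectivization.ind with | h v hv =>
  induction l using Projectivization.ind with | h l hl =>
  obtain ⟨a, b, ha, hb, hab, hav, hbl⟩ := exists_seq_tendsto_of_mk_mem_closure hv hl hpX
  obtain ⟨L, u, hu, hL⟩ := exists_subseq_subspaceTendsto
    fun k => tangentSpaceAt X (Projectivization.mk ℂ (a k) (ha k))
  have hTL := h _ hy _ L (fun k => (hab (u k)).1)
    (tendsto_projectivization_mk (fun k => ha (u k)) hv (hav.comp hu.tendsto_atTop)) hL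
  refine (mk_mem_conormalPairs_iff_of_mem_regPoints (hUreg hy) hl).2 fun w hw => ?_
  have hwL : L.starProjection w = w := Submodule.starProjection_eq_self_iff.2 (hTL hw)
  -- The vector `w ∈ L` is the limit of its projections to the tangent spaces of `X`, and these are
  -- killed by the forms `b (u k)`.
  have hlim := tendsto_sum_mul (hbl.comp hu.tendsto_atTop) (hL.apply w)
  rw [hwL] at hlim
  refine tendsto_nhds_unique hlim (tendsto_const_nhds.congr fun k => ?_)
  exact ((mk_mem_conormalPairs_iff_of_mem_regPoints (hab (u k)).1 (hb (u k))).1 (hab (u k)) _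
    (Submodule.starProjection_apply_mem _ w)).symm

theorem whitneyA_of_conormalPreimage_subset {n : ℕ} {X U : Set (ProjSpace n)}
    (hUreg : U ⊆ regPoints U)
    (h : conormalPreimage X U ⊆ conormalSpace X ∩ conormalSpace U) : WhitneyA X U := by
  intro y hy x L hx hxy hL w hw
  by_contra hwL
  let conj : CoordSpace n → CoordSpace n := fun a =>
    WithLp.toLp 2 fun i => starRingEnd ℂ (a.ofLp i)
  have hconj : Continuous conj := by
    refine (PiLp.continuous_toLp 2 _).comp (continuous_pi fun i => ?_)
    exact Complex.continuous_conj.comp (EuclideanSpace.proj (𝕜 := ℂ) i).continuous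
  have hconj0 : ∀ a, conj a ≠ 0 ↔ a ≠ 0 := fun a => not_congr
    ⟨fun h0 => PiLp.ext fun i => by simpa [conj] using congrFun (congrArg WithLp.ofLp h0) i,
      fun h0 => PiLp.ext fun i => by simp [conj, h0]⟩
  -- The conjugate of the component of `w` orthogonal to `T` is a linear form that kills `T`.
  have hperp : ∀ (T : Submodule ℂ (CoordSpace n)), ∀ t ∈ T,
      ∑ i, (conj (w - T.starProjection w)).ofLp i * t.ofLp i = 0 := fun T t ht =>
    (sum_conj_mul_eq_inner _ _).trans
      (Submodule.inner_left_of_mem_orthogonal ht (T.sub_starProjection_mem_orthogonal w))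
  have hne : w - L.starProjection w ≠ 0 := fun h0 =>
    hwL (Submodule.starProjection_eq_self_iff.1 (sub_eq_zero.1 h0).symm)
  have hlim : Tendsto (fun k => conj (w - (tangentSpaceAt X (x k)).starProjection w)) atTop
      (𝓝 (conj (w - L.starProjection w))) :=
    (hconj.tendsto _).comp (tendsto_const_nhds.sub (hL.apply w))
  have hmem : (y, Projectivization.mk ℂ _ ((hconj0 _).2 hne)) ∈ conormalSpace X := by
    -- The first terms are dropped because there `w` may lie in the tangent space, and the form
    -- would be zero.
    obtain ⟨K, hK⟩ := eventually_atTop.1 (hlim.eventually_ne ((hconj0 _).2 hne))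
    refine mem_closure_of_tendsto (b := atTop) (f := fun k => (x (k + K), Projectivization.mk ℂ _
      (hK (k + K) (Nat.le_add_left _ _)))) ?_ (Eventually.of_forall fun k =>
        (mk_mem_conormalPairs_iff_of_mem_regPoints (hx _) _).2 (hperp _))
    exact ((tendsto_add_atTop_iff_nat K).2 hxy).prodMk_nhds
      (tendsto_projectivization_mk _ _ ((tendsto_add_atTop_iff_nat K).2 hlim))
  have hU := conormalSpace_inter_fiber_subset hUreg
    (h (mem_conormalPreimage_iff.2 ⟨hmem, hy⟩)).2 hy
  have h1 := (mk_mem_conormalPairs_iff_of_mem_regPoints (hUreg hy) _).1 hU w hw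
  have h2 : inner ℂ (w - L.starProjection w) w = (0 : ℂ) := by
    rw [← sum_conj_mul_eq_inner]
    exact h1
  have h3 : inner ℂ (w - L.starProjection w) (L.starProjection w) = (0 : ℂ) :=
    Submodule.inner_left_of_mem_orthogonal (Submodule.starProjection_apply_mem _ w)
      (L.sub_starProjection_mem_orthogonal w)
  -- The vector `w - L.starProjection w` is orthogonal to `w` by conormality and to the projection
  -- of `w` by construction, hence to itself.
  refine hne (inner_self_eq_zero (𝕜 := ℂ).1 ?_)
  rw [inner_sub_right, h2, h3, sub_zero]

theorem corollary5p3 (n : ℕ) (X Y U : Set (ProjSpace n))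
    (hX : IsIrreducibleVariety X) (hY : IsIrreducibleVariety Y) (hYX : Y ⊆ X)
    (hU : IsZariskiOpenIn U Y) (hUreg : U ⊆ regPoints Y) :
    (WhitneyA X U ↔
      (conormalInterIdeal X U).radical ≤ (conormalPreimageIdeal X Y U).radical) ∧
    ((conormalInterIdeal X U).radical ≤ (conormalPreimageIdeal X Y U).radical ↔
      conormalPreimage X U ⊆ conormalSpace X ∩ conormalSpace U) := by
  have hUU := subset_regPoints_of_isZariskiOpenIn hY hU hUreg
  have h1 := radical_le_radical_iff_conormalPreimage_subset hX.1 hY.1 hU hUU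
  exact ⟨⟨fun h => h1.2 (conormalPreimage_subset_of_whitneyA hUU h),
    fun h => whitneyA_of_conormalPreimage_subset hUU (h1.1 h)⟩, h1⟩
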